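/- Let $C[0,1]^d$ be the space of continuous functions $f:[0,1]^d\to\mathbb R$, with graph $G_f=\{(x,f(x)):x\in[0,1]^d\}\subset\mathbb R^{d+1}$. For $f\in C[0,1]^2$ let $H(f)\in C[0,1]$, $H(f)(x)=\sup_{y\in[0,1]}f(x,y)$, be its horizon function. For a bounded set $E\subset\mathbb R^n$ let $N_\delta(E)$ be the number of cubes of the $\delta$-mesh that intersect $E$, and let $\underline{\dim}_B E$ and $\overline{\dim}_B E$ be the lower and upper limits of $\log N_\delta(E)/(-\log\delta)$ as $\delta\to0^+$; if they agree, the common value is denoted by $\dim_B E$. For $\alpha\in[2,3]$ let $C_\alpha[0,1]^2=\{f\in C[0,1]^2:\overline{\dim}_B G_f\le\alpha\}$ and $$F_\alpha[0,1]^2=\{f\in C_\alpha[0,1]^2:\ \dim_B G_f=\alpha \text{ and } \alpha-1\le\underline{\dim}_B G_{H(f)}\le\overline{\dim}_B G_{H(f)}\le 2\}.$$ For $\alpha\in[2,3)$ the vector space $C_\alpha[0,1]^2$ carries the complete metric $$d_{\alpha,2}(f,g)=\sum_{k=1}^\infty\min\{2^{-k},\|f-g\|_{\alpha+1/k,2}\},\qquad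 \|f\|_{\beta,2}=\|f\|_\infty+\sup_{0<\delta\le1}\frac{\sum_{S\in\Delta_\delta}R_f(S)}{\delta^{1-\beta}},$$ where $\Delta_\delta$ is the set of the squares $[n_1\delta,(n_1+1)\delta]\times[n_2\delta,(n_2+1)\delta]$ with $0\le n_1,n_2\le\lceil\delta^{-1}\rceil-1$, and $R_f(S)=\sup_{x,y\in S\cap[0,1]^2}|f(x)-f(y)|$. A subset $F$ of a completely metrizable topological vector space $X$ is called $1$-prevalent if $F$ is a Borel set and there is a one-dimensional subspace $P\subseteq X$ such that $\mathcal L_P(X\setminus(F+x))=0$ for all $x\in X$, where $\mathcal L_P$ is one-dimensional Lebesgue measure on $P$. Theorem 1.2. (1) $F_3[0,1]^2$ is a $1$-prevalent subset of $C[0,1]^2$ with the supremum norm. In particular, all surfaces in this $1$-prevalent set satisfy $\dim_B G_f=3$ and $\dim_B G_{H(f)}=2$. (2) For every $\alpha\in[2,3)$, the set $F_\alpha[0,1]^2$ is a $1$-prevalent subset of $(C_\alpha[0,1]^2,d_{\alpha,2})$. -/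

import Mathlib

open Filter Topology MeasureTheory
open scoped ENNReal unitInterval

namespace Horizon

/-! ### Box dimensions -/

/-- The cube `∏ i, [m i * δ, (m i + 1) * δ]` of the `δ`-mesh of `ℝⁿ`. -/
def meshCube {n : ℕ} (δ : ℝ) (m : Fin n → ℤ) : Set (Fin n → ℝ) :=
  {x | ∀ i, (m i : ℝ) * δ ≤ x i ∧ x i ≤ ((m i : ℝ) + 1) * δ}

/-- `N_δ(F)`: the number of cubes of the `δ`-mesh that intersect the (bounded) set `F`. -/
noncomputable def boxCount {n : ℕ} (δ : ℝ) (F : Set (Fin n → ℝ)) : ℕ :=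
  {m : Fin n → ℤ | (meshCube δ m ∩ F).Nonempty}.ncard

/-- The lower box dimension of a bounded subset of `ℝⁿ`. -/
noncomputable def lowerBoxDim {n : ℕ} (F : Set (Fin n → ℝ)) : EReal :=
  liminf (fun δ : ℝ => ((Real.log (boxCount δ F) / -Real.log δ : ℝ) : EReal)) (𝓝[>] 0)

/-- The upper box dimension of a bounded subset of `ℝⁿ`. -/
noncomputable def upperBoxDim {n : ℕ} (F : Set (Fin n → ℝ)) : EReal :=
  limsup (fun δ : ℝ => ((Real.log (boxCount δ F) / -Real.log δ : ℝ) : EReal)) (𝓝[>] 0)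

/-- The box dimension of `F` exists and equals `s`. -/
def HasBoxDim {n : ℕ} (F : Set (Fin n → ℝ)) (s : EReal) : Prop :=
  lowerBoxDim F = s ∧ upperBoxDim F = s

/-! ### Continuous functions on the cube, graphs and horizons -/

/-- The space `C[0,1]^d`; its topology is that of the supremum norm. -/
abbrev CCube (d : ℕ) : Type := C(Fin d → I, ℝ)

/-- The graph of `f`, as a subset of `ℝ^(d+1)`; the value of `f` is the last coordinate. -/
def graph {d : ℕ} (f : CCube d) : Set (Fin (d + 1) → ℝ) :=
  Set.range fun x : Fin d → I => Fin.snoc (α := fun _ => ℝ) (fun i => (x i : ℝ)) (f x)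

/-- The horizon function `H(f)(x) = sup_{y ∈ [0,1]} f(x,y)`. -/
noncomputable def horizon (f : CCube 2) : CCube 1 where
  toFun x := ⨆ y : I, f ![x 0, y]
  continuous_toFun := by
    have h : Continuous fun x : Fin 1 → I =>
        sSup ((fun y : I => f ![x 0, y]) '' (Set.univ : Set I)) := by
      refine isCompact_univ.continuous_sSup (f := fun (x : Fin 1 → I) (y : I) => f ![x 0, y]) ?_
      refine f.continuous.comp (continuous_pi fun i => ?_)
      fin_cases i
      · exact (continuous_apply (0 : Fin 1)).comp
          (continuous_fst : Continuous (Prod.fst : (Fin 1 → I) × I → Fin 1 → I))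
      · exact (continuous_snd : Continuous (Prod.snd : (Fin 1 → I) × I → I))
    simpa only [Set.image_univ, sSup_range] using h

/-! ### The metrics on the spaces of functions with graphs of bounded upper box dimension -/

/-- The cube `∏ i, [n i * δ, (n i + 1) * δ]` of the `δ`-mesh on `[0,1]^d` (its part in `[0,1]^d`).
The indices `n i` run through `0, …, ⌈1 / δ⌉ - 1`. -/
def gridCube {d : ℕ} (δ : ℝ) (n : Fin d → Fin ⌈δ⁻¹⌉₊) : Set (Fin d → I) :=
  {x | ∀ i, ((n i : ℕ) : ℝ) * δ ≤ x i ∧ (x i : ℝ) ≤ (((n i : ℕ) : ℝ) + 1) * δ}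

/-- The range `R_f(S) = sup_{x, y ∈ S} |f(x) - f(y)|`. -/
noncomputable def osc {d : ℕ} (f : CCube d) (S : Set (Fin d → I)) : ℝ≥0∞ :=
  ⨆ x ∈ S, ⨆ y ∈ S, ENNReal.ofReal |f x - f y|

/-- The sum of the ranges of `f` over all cubes of the `δ`-mesh on `[0,1]^d`. -/
noncomputable def oscSum {d : ℕ} (δ : ℝ) (f : CCube d) : ℝ≥0∞ :=
  ∑ n : Fin d → Fin ⌈δ⁻¹⌉₊, osc f (gridCube δ n)

/-- The norm `‖f‖_{β,d} = ‖f‖_∞ + sup_{0 < δ ≤ 1} (∑_S R_f(S)) / δ^(1-β)`,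
with the value `∞` where `f` is not in the space `V_β[0,1]^d`. -/
noncomputable def boxNorm {d : ℕ} (β : ℝ) (f : CCube d) : ℝ≥0∞ :=
  ENNReal.ofReal ‖f‖ + ⨆ δ ∈ Set.Ioc (0 : ℝ) 1, oscSum δ f / ENNReal.ofReal (δ ^ (1 - β))

/-- `d_{α,d}(f,g) = ∑_{k ≥ 1} min {2^(-k), ‖f - g‖_{α+1/k,d}}` (summed over `k + 1` with `k ≥ 0`). -/
noncomputable def boxEDist {d : ℕ} (α : ℝ) (f g : CCube d) : ℝ≥0∞ :=
  ∑' k : ℕ, min ((2 : ℝ≥0∞)⁻¹ ^ (k + 1)) (boxNorm (α + 1 / ((k : ℝ) + 1)) (f - g))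

/-! #### Ranges and the box-counting function -/

lemma ofReal_abs_le_osc {d : ℕ} (f : CCube d) {S : Set (Fin d → I)} {x y : Fin d → I}
    (hx : x ∈ S) (hy : y ∈ S) : ENNReal.ofReal |f x - f y| ≤ osc f S :=
  le_trans (le_iSup₂ (f := fun y (_ : y ∈ S) => ENNReal.ofReal |f x - f y|) y hy)
    (le_iSup₂ (f := fun x (_ : x ∈ S) => ⨆ y ∈ S, ENNReal.ofReal |f x - f y|) x hx)

lemma osc_le_iff {d : ℕ} (f : CCube d) (S : Set (Fin d → I)) (c : ℝ≥0∞) :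
    osc f S ≤ c ↔ ∀ x ∈ S, ∀ y ∈ S, ENNReal.ofReal |f x - f y| ≤ c := by
  simp only [osc, iSup_le_iff]

lemma osc_le_norm {d : ℕ} (f : CCube d) (S : Set (Fin d → I)) :
    osc f S ≤ ENNReal.ofReal (2 * ‖f‖) := by
  rw [osc_le_iff]
  intro x _ y _
  apply ENNReal.ofReal_le_ofReal
  have h1 := f.norm_coe_le_norm x
  have h2 := f.norm_coe_le_norm y
  have h3 := abs_sub (f x) (f y)
  simp only [Real.norm_eq_abs] at h1 h2
  linarith

lemma osc_ne_top {d : ℕ} (f : CCube d) (S : Set (Fin d → I)) : osc f S ≠ ⊤ :=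
  ne_top_of_le_ne_top ENNReal.ofReal_ne_top (osc_le_norm f S)

lemma oscSum_le_card {d : ℕ} (δ : ℝ) (f : CCube d) :
    oscSum δ f ≤ (⌈δ⁻¹⌉₊ : ℝ≥0∞) ^ d * ENNReal.ofReal (2 * ‖f‖) := by
  unfold oscSum
  refine (Finset.sum_le_card_nsmul _ _ _ fun n _ => osc_le_norm f _).trans ?_
  simp

lemma isPreconnected_gridCube {d : ℕ} (δ : ℝ) (n : Fin d → Fin ⌈δ⁻¹⌉₊) :
    IsPreconnected (gridCube δ n) := by
  have h : gridCube δ n = Set.univ.pi fun i =>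
      {t : I | ((n i : ℕ) : ℝ) * δ ≤ t ∧ (t : ℝ) ≤ (((n i : ℕ) : ℝ) + 1) * δ} := by
    ext x; simp [gridCube]
  rw [h]
  refine isPreconnected_univ_pi fun i => ?_
  refine Set.OrdConnected.isPreconnected ⟨fun a ha b hb c hc => ?_⟩
  exact ⟨ha.1.trans (Subtype.coe_le_coe.2 hc.1), le_trans (Subtype.coe_le_coe.2 hc.2) hb.2⟩

/-- The vertical indices of the mesh cubes above `gridCube δ n` that meet the graph. -/
def column {d : ℕ} (f : CCube d) (δ : ℝ) (n : Fin d → Fin ⌈δ⁻¹⌉₊) : Set ℤ :=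
  {m | ∃ x ∈ gridCube δ n, (m : ℝ) * δ ≤ f x ∧ f x ≤ ((m : ℝ) + 1) * δ}

lemma column_subset {d : ℕ} (f : CCube d) {δ : ℝ} (hδ : 0 < δ) (n : Fin d → Fin ⌈δ⁻¹⌉₊)
    {x₀ : Fin d → I} (hx₀ : x₀ ∈ gridCube δ n) :
    column f δ n ⊆ Set.Icc ⌈(f x₀ - (osc f (gridCube δ n)).toReal) / δ - 1⌉
      ⌊(f x₀ + (osc f (gridCube δ n)).toReal) / δ⌋ := by
  rintro m ⟨x, hx, h1, h2⟩
  have h := ofReal_abs_le_osc f hx hx₀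
  rw [ENNReal.ofReal_le_iff_le_toReal (osc_ne_top _ _), abs_le] at h
  constructor
  · rw [Int.ceil_le, sub_le_iff_le_add, div_le_iff₀ hδ]; linarith [h.1]
  · rw [Int.le_floor, le_div_iff₀ hδ]; linarith [h.2]

lemma column_finite {d : ℕ} (f : CCube d) {δ : ℝ} (hδ : 0 < δ) (n : Fin d → Fin ⌈δ⁻¹⌉₊) :
    (column f δ n).Finite := by
  rcases (gridCube δ n).eq_empty_or_nonempty with h | ⟨x₀, hx₀⟩
  · simp [column, h]
  · exact (Set.finite_Icc _ _).subset (column_subset f hδ n hx₀)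

lemma column_ncard_le {d : ℕ} (f : CCube d) {δ : ℝ} (hδ : 0 < δ) (n : Fin d → Fin ⌈δ⁻¹⌉₊) :
    ((column f δ n).ncard : ℝ) ≤ 2 * (osc f (gridCube δ n)).toReal / δ + 2 := by
  rcases (gridCube δ n).eq_empty_or_nonempty with h | ⟨x₀, hx₀⟩
  · simp only [column, h, Set.mem_empty_iff_false, false_and, exists_false, Set.ofPred_false,
      Set.ncard_empty, Nat.cast_zero]
    positivity
  · have h1 := Set.ncard_le_ncard (column_subset f hδ n hx₀) (Set.finite_Icc _ _)
    set r := (osc f (gridCube δ n)).toReal with hr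
    have hr0 : 0 ≤ r := ENNReal.toReal_nonneg
    rw [← Finset.coe_Icc, Set.ncard_coe_finset, Int.card_Icc] at h1
    have h2 : ((column f δ n).ncard : ℝ) ≤
        ((⌊(f x₀ + r) / δ⌋ + 1 - ⌈(f x₀ - r) / δ - 1⌉).toNat : ℝ) := by exact_mod_cast h1
    refine h2.trans ?_
    rcases le_total 0 (⌊(f x₀ + r) / δ⌋ + 1 - ⌈(f x₀ - r) / δ - 1⌉) with h0 | h0
    · have h3 : ((⌊(f x₀ + r) / δ⌋ + 1 - ⌈(f x₀ - r) / δ - 1⌉).toNat : ℝ) =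
          ((⌊(f x₀ + r) / δ⌋ + 1 - ⌈(f x₀ - r) / δ - 1⌉ : ℤ) : ℝ) := by
        exact_mod_cast Int.toNat_of_nonneg h0
      rw [h3]
      push_cast
      have h4 := Int.floor_le ((f x₀ + r) / δ)
      have h5 := Int.le_ceil ((f x₀ - r) / δ - 1)
      have h6 : 2 * r / δ = (f x₀ + r) / δ - (f x₀ - r) / δ := by ring
      linarith
    · rw [Int.toNat_of_nonpos h0]
      simp only [Nat.cast_zero]
      positivity

lemma osc_le_column {d : ℕ} (f : CCube d) {δ : ℝ} (hδ : 0 < δ) (n : Fin d → Fin ⌈δ⁻¹⌉₊) :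
    osc f (gridCube δ n) ≤ ENNReal.ofReal (δ * (column f δ n).ncard) := by
  rw [osc_le_iff]
  have key : ∀ x ∈ gridCube δ n, ∀ y ∈ gridCube δ n, f x ≤ f y →
      f y - f x ≤ δ * (column f δ n).ncard := by
    intro x hx y hy hxy
    have hsub : Set.Icc ⌊f x / δ⌋ ⌊f y / δ⌋ ⊆ column f δ n := by
      rintro m ⟨hm1, hm2⟩
      have h1 : f x < ((m : ℝ) + 1) * δ := by
        rw [← div_lt_iff₀ hδ]
        have := Int.lt_floor_add_one (f x / δ)
        have h' : ((⌊f x / δ⌋ : ℤ) : ℝ) ≤ m := by exact_mod_cast hm1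
        linarith
      have h2 : (m : ℝ) * δ ≤ f y := by
        rw [← le_div_iff₀ hδ]; exact Int.le_floor.1 hm2
      have hv : max ((m : ℝ) * δ) (f x) ∈ Set.Icc (f x) (f y) :=
        ⟨le_max_right _ _, max_le h2 hxy⟩
      obtain ⟨z, hz, hfz⟩ := (isPreconnected_gridCube δ n).intermediate_value hx hy
        f.continuous.continuousOn hv
      refine ⟨z, hz, ?_, ?_⟩
      · rw [hfz]; exact le_max_left _ _
      · rw [hfz]; exact max_le (by linarith) h1.le
    have h1 := Set.ncard_le_ncard hsub (column_finite f hδ n)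
    rw [← Finset.coe_Icc, Set.ncard_coe_finset, Int.card_Icc] at h1
    have h2 : f y / δ - f x / δ ≤ (column f δ n).ncard := by
      have h3 : ((⌊f y / δ⌋ + 1 - ⌊f x / δ⌋ : ℤ) : ℝ) ≤ (column f δ n).ncard := by
        exact_mod_cast (Int.self_le_toNat _).trans (by exact_mod_cast h1)
      push_cast at h3
      have h4 := Int.lt_floor_add_one (f y / δ)
      have h5 := Int.floor_le (f x / δ)
      linarith
    rw [← sub_div, div_le_iff₀ hδ] at h2
    linarith
  intro x hx y hy
  apply ENNReal.ofReal_le_ofReal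
  rcases le_total (f x) (f y) with h | h
  · rw [abs_sub_comm, abs_of_nonneg (by linarith)]; exact key x hx y hy h
  · rw [abs_of_nonneg (by linarith)]; exact key y hy x hx h

lemma mem_hit_iff {d : ℕ} (f : CCube d) (δ : ℝ) (m : Fin (d + 1) → ℤ) :
    (meshCube δ m ∩ graph f).Nonempty ↔
      ∃ x : Fin d → I, (∀ i : Fin d, (m i.castSucc : ℝ) * δ ≤ x i ∧
        (x i : ℝ) ≤ ((m i.castSucc : ℝ) + 1) * δ) ∧
        (m (Fin.last d) : ℝ) * δ ≤ f x ∧ f x ≤ ((m (Fin.last d) : ℝ) + 1) * δ := by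
  constructor
  · rintro ⟨_, hm, x, rfl⟩
    refine ⟨x, fun i => ?_, ?_⟩
    · have := hm i.castSucc
      simpa only [Fin.snoc_castSucc] using this
    · have := hm (Fin.last d)
      simpa only [Fin.snoc_last] using this
  · rintro ⟨x, h1, h2⟩
    refine ⟨_, fun i => ?_, x, rfl⟩
    refine Fin.lastCases ?_ (fun i => ?_) i
    · simpa only [Fin.snoc_last] using h2
    · simpa only [Fin.snoc_castSucc] using h1 i

lemma exists_gridCube {d : ℕ} {δ : ℝ} (hδ : 0 < δ) (x : Fin d → I) :
    ∃ n : Fin d → Fin ⌈δ⁻¹⌉₊, x ∈ gridCube δ n := by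
  have hK : 0 < ⌈δ⁻¹⌉₊ := Nat.ceil_pos.2 (inv_pos.2 hδ)
  have hc := Nat.le_ceil δ⁻¹
  refine ⟨fun i => ⟨min ⌊(x i : ℝ) / δ⌋₊ (⌈δ⁻¹⌉₊ - 1), by omega⟩, fun i => ?_⟩
  have hx0 : (0 : ℝ) ≤ x i := (x i).2.1
  have hx1 : (x i : ℝ) ≤ 1 := (x i).2.2
  have hfl := Nat.floor_le (div_nonneg hx0 hδ.le)
  constructor
  · rw [← le_div_iff₀ hδ]
    refine le_trans ?_ hfl
    exact_mod_cast min_le_left _ _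
  · rw [← div_le_iff₀ hδ]
    dsimp only
    rcases le_total ⌊(x i : ℝ) / δ⌋₊ (⌈δ⁻¹⌉₊ - 1) with h | h
    · rw [min_eq_left h]; exact (Nat.lt_floor_add_one _).le
    · rw [min_eq_right h]
      have h1 : (((⌈δ⁻¹⌉₊ - 1 : ℕ) : ℝ) + 1) = ⌈δ⁻¹⌉₊ := by
        exact_mod_cast Nat.sub_add_cancel hK
      rw [h1]
      refine le_trans ?_ hc
      rw [div_eq_mul_inv]
      exact mul_le_of_le_one_left (inv_pos.2 hδ).le hx1

/-- The mesh cubes meeting the graph lie near the columns. -/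
lemma hit_subset {d : ℕ} (f : CCube d) {δ : ℝ} (hδ : 0 < δ) :
    {m : Fin (d + 1) → ℤ | (meshCube δ m ∩ graph f).Nonempty} ⊆
      ⋃ n : Fin d → Fin ⌈δ⁻¹⌉₊, (fun p : (Fin d → ℤ) × ℤ => Fin.snoc (α := fun _ => ℤ) p.1 p.2) ''
        ((Set.Icc (fun i => ((n i : ℕ) : ℤ) - 1) (fun i => ((n i : ℕ) : ℤ) + 1)) ×ˢ
          column f δ n) := by
  intro m hm
  obtain ⟨x, h1, h2⟩ := (mem_hit_iff f δ m).1 hm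
  obtain ⟨n, hn⟩ := exists_gridCube hδ x
  refine Set.mem_iUnion.2 ⟨n, ⟨(fun i => m i.castSucc, m (Fin.last d)), ⟨⟨fun i => ?_, fun i => ?_⟩,
    x, hn, h2⟩, ?_⟩⟩
  · have h3 := (hn i).1.trans (h1 i).2
    have h4 := le_of_mul_le_mul_right h3 hδ
    have h5 : ((n i : ℕ) : ℤ) ≤ m i.castSucc + 1 := by exact_mod_cast h4
    dsimp only; omega
  · have h3 := (h1 i).1.trans (hn i).2
    have h4 := le_of_mul_le_mul_right h3 hδ
    have h5 : m i.castSucc ≤ ((n i : ℕ) : ℤ) + 1 := by exact_mod_cast h4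
    dsimp only; omega
  · exact Fin.snoc_init_self m

lemma hit_finite {d : ℕ} (f : CCube d) {δ : ℝ} (hδ : 0 < δ) :
    {m : Fin (d + 1) → ℤ | (meshCube δ m ∩ graph f).Nonempty}.Finite :=
  (Set.finite_iUnion fun n =>
    (((Set.finite_Icc _ _).prod (column_finite f hδ n)).image _)).subset (hit_subset f hδ)

lemma boxCount_le {d : ℕ} (f : CCube d) {δ : ℝ} (hδ : 0 < δ) :
    (boxCount δ (graph f) : ℝ) ≤ 3 ^ d * (2 * (oscSum δ f).toReal / δ + 2 * (⌈δ⁻¹⌉₊ : ℝ) ^ d) := by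
  have h1 : boxCount δ (graph f) ≤ ∑ n : Fin d → Fin ⌈δ⁻¹⌉₊, 3 ^ d * (column f δ n).ncard := by
    refine (Set.ncard_le_ncard (hit_subset f hδ) (Set.finite_iUnion fun n =>
      (((Set.finite_Icc _ _).prod (column_finite f hδ n)).image _))).trans ?_
    have hU := Finset.set_ncard_biUnion_le (Finset.univ : Finset (Fin d → Fin ⌈δ⁻¹⌉₊))
      (fun n => (fun p : (Fin d → ℤ) × ℤ => Fin.snoc (α := fun _ => ℤ) p.1 p.2) ''
        ((Set.Icc (fun i => ((n i : ℕ) : ℤ) - 1) (fun i => ((n i : ℕ) : ℤ) + 1)) ×ˢ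
          column f δ n))
    simp only [Finset.mem_univ, Set.iUnion_true] at hU
    refine hU.trans (Finset.sum_le_sum fun n _ => ?_)
    refine (Set.ncard_image_le ((Set.finite_Icc _ _).prod (column_finite f hδ n))).trans ?_
    rw [Set.ncard_prod]
    refine Nat.mul_le_mul_right _ (le_of_eq ?_)
    rw [← Finset.coe_Icc, Set.ncard_coe_finset, Pi.card_Icc]
    have h3 : ∀ i : Fin d, (Finset.Icc (((n i : ℕ) : ℤ) - 1) (((n i : ℕ) : ℤ) + 1)).card = 3 := by
      intro i; rw [Int.card_Icc]; omega
    simp [h3]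
  have h2 : (boxCount δ (graph f) : ℝ) ≤
      ∑ n : Fin d → Fin ⌈δ⁻¹⌉₊, 3 ^ d * ((column f δ n).ncard : ℝ) := by exact_mod_cast h1
  refine h2.trans ?_
  rw [← Finset.mul_sum]
  refine mul_le_mul_of_nonneg_left ?_ (by positivity)
  refine (Finset.sum_le_sum fun n _ => column_ncard_le f hδ n).trans (le_of_eq ?_)
  rw [Finset.sum_add_distrib, oscSum, ENNReal.toReal_sum fun n _ => osc_ne_top f _,
    Finset.mul_sum, Finset.sum_div]
  simp [mul_comm]

lemma oscSum_le {d : ℕ} (f : CCube d) {δ : ℝ} (hδ : 0 < δ) :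
    oscSum δ f ≤ ENNReal.ofReal (δ * boxCount δ (graph f)) := by
  have h1 : ∑ n : Fin d → Fin ⌈δ⁻¹⌉₊, (column f δ n).ncard ≤ boxCount δ (graph f) := by
    classical
    have hs : ∑ n : Fin d → Fin ⌈δ⁻¹⌉₊, (column f δ n).ncard =
        (Finset.univ.sigma fun n : Fin d → Fin ⌈δ⁻¹⌉₊ => (column_finite f hδ n).toFinset).card := by
      rw [Finset.card_sigma]
      exact Finset.sum_congr rfl fun n _ => Set.ncard_eq_toFinset_card _ (column_finite f hδ n)
    rw [hs, boxCount, Set.ncard_eq_toFinset_card _ (hit_finite f hδ)]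
    refine Finset.card_le_card_of_injOn
      (fun p => Fin.snoc (α := fun _ => ℤ) (fun i => ((p.1 i : ℕ) : ℤ)) p.2) ?_ ?_
    · rintro ⟨n, m⟩ hm
      simp only [Finset.coe_sigma, Set.mem_sigma_iff, Finset.coe_univ, Set.mem_univ, true_and,
        Set.Finite.coe_toFinset] at hm
      obtain ⟨x, hx, h⟩ := hm
      simp only [Set.Finite.coe_toFinset, Set.mem_ofPred_eq]
      rw [mem_hit_iff]
      refine ⟨x, fun i => ?_, ?_⟩
      · simpa only [Fin.snoc_castSucc, Int.cast_natCast] using hx i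
      · simpa only [Fin.snoc_last] using h
    · rintro ⟨n, m⟩ _ ⟨n', m'⟩ _ h
      have ha : n = n' := by
        funext i
        have := congrFun h i.castSucc
        simp only [Fin.snoc_castSucc] at this
        exact Fin.ext (by exact_mod_cast this)
      have hb : m = m' := by
        have := congrFun h (Fin.last d)
        simpa only [Fin.snoc_last] using this
      subst ha; subst hb; rfl
  unfold oscSum
  refine (Finset.sum_le_sum fun n _ => osc_le_column f hδ n).trans ?_
  rw [← ENNReal.ofReal_sum_of_nonneg fun n _ => by positivity, ← Finset.mul_sum]
  refine ENNReal.ofReal_le_ofReal (mul_le_mul_of_nonneg_left ?_ hδ.le)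
  exact_mod_cast h1

/-! #### The norms `‖·‖_{β,d}` and the upper box dimension -/

lemma boxNorm_ne_top {d : ℕ} {f : CCube d} {α β : ℝ} (hα : 0 ≤ α) (hαβ : α < β)
    (hf : upperBoxDim (graph f) ≤ (α : EReal)) : boxNorm β f ≠ ⊤ := by
  have hlt : upperBoxDim (graph f) < (β : EReal) :=
    hf.trans_lt (EReal.coe_lt_coe_iff.2 hαβ)
  have hev := eventually_lt_of_limsup_lt hlt
  have hev1 : ∀ᶠ δ : ℝ in 𝓝[>] 0, δ < 1 := eventually_nhdsWithin_of_eventually_nhds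
    (eventually_lt_nhds one_pos)
  obtain ⟨δ₀, hδ₀, hsub⟩ := mem_nhdsGT_iff_exists_Ioo_subset.1 (hev.and hev1)
  have hδ₀ : 0 < δ₀ := hδ₀
  have hsmall : ∀ δ : ℝ, 0 < δ → δ < δ₀ → oscSum δ f ≤ ENNReal.ofReal (δ ^ (1 - β)) := by
    intro δ h0 h1
    obtain ⟨h2, h3⟩ := hsub ⟨h0, h1⟩
    have h2 := EReal.coe_lt_coe_iff.1 h2
    refine (oscSum_le f h0).trans (ENNReal.ofReal_le_ofReal ?_)
    have hlog : 0 < -Real.log δ := neg_pos.2 (Real.log_neg h0 h3)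
    rw [div_lt_iff₀ hlog] at h2
    have h4 : (boxCount δ (graph f) : ℝ) ≤ δ ^ (-β) := by
      rcases (boxCount δ (graph f)).eq_zero_or_pos with hN | hN
      · rw [hN]; simp only [Nat.cast_zero]; positivity
      · have hN' : (0 : ℝ) < boxCount δ (graph f) := by exact_mod_cast hN
        rw [← Real.log_le_log_iff hN' (by positivity), Real.log_rpow h0]
        linarith
    have h5 : δ ^ (1 - β) = δ * δ ^ (-β) := by
      rw [sub_eq_add_neg, Real.rpow_add h0, Real.rpow_one]
    rw [h5]
    exact mul_le_mul_of_nonneg_left h4 h0.le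
  set M : ℝ≥0∞ := (⌈δ₀⁻¹⌉₊ : ℝ≥0∞) ^ d * ENNReal.ofReal (2 * ‖f‖) / ENNReal.ofReal δ₀ with hM
  have hMtop : M ≠ ⊤ := by
    refine ENNReal.div_ne_top (ENNReal.mul_ne_top (by finiteness) ENNReal.ofReal_ne_top) ?_
    simpa using hδ₀
  have hsup : (⨆ δ ∈ Set.Ioc (0 : ℝ) 1, oscSum δ f / ENNReal.ofReal (δ ^ (1 - β))) ≤ 1 + M := by
    refine iSup₂_le fun δ hδ => ?_
    rcases lt_or_ge δ δ₀ with h | h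
    · refine le_trans ?_ le_self_add
      refine ENNReal.div_le_of_le_mul ?_
      rw [one_mul]; exact hsmall δ hδ.1 h
    · refine le_trans ?_ le_add_self
      rw [hM]
      refine ENNReal.div_le_div ((oscSum_le_card δ f).trans ?_) (ENNReal.ofReal_le_ofReal ?_)
      · refine mul_le_mul_left (pow_le_pow_left₀ zero_le ?_ d) _
        exact_mod_cast Nat.ceil_mono (inv_anti₀ hδ₀ h)
      · have h5 : δ ^ (1 - β) = δ * δ ^ (-β) := by
          rw [sub_eq_add_neg, Real.rpow_add hδ.1, Real.rpow_one]
        have h6 : 1 ≤ δ ^ (-β) := Real.one_le_rpow_of_pos_of_le_one_of_nonpos hδ.1 hδ.2 (by linarith)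
        rw [h5]
        nlinarith [hδ.1]
  unfold boxNorm
  exact ENNReal.add_ne_top.2 ⟨ENNReal.ofReal_ne_top,
    ne_top_of_le_ne_top (ENNReal.add_ne_top.2 ⟨ENNReal.one_ne_top, hMtop⟩) hsup⟩

lemma upperBoxDim_le_of_boxNorm {d : ℕ} {f : CCube d} {β : ℝ} (hβ : (d : ℝ) ≤ β)
    (hf : boxNorm β f ≠ ⊤) : upperBoxDim (graph f) ≤ (β : EReal) := by
  have hβ0 : 0 ≤ β := (Nat.cast_nonneg d).trans hβ
  set C : ℝ := (boxNorm β f).toReal with hC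
  have hC0 : 0 ≤ C := ENNReal.toReal_nonneg
  set K : ℝ := 3 ^ d * (2 * C + 2 * 2 ^ d) with hK
  have hK1 : 1 ≤ K := by
    have h3 : (1 : ℝ) ≤ 3 ^ d := one_le_pow₀ (by norm_num)
    have h2 : (1 : ℝ) ≤ 2 ^ d := one_le_pow₀ (by norm_num)
    rw [hK]; nlinarith
  have hbound : ∀ δ : ℝ, 0 < δ → δ < 1 → Real.log (boxCount δ (graph f)) / -Real.log δ ≤
      Real.log K / -Real.log δ + β := by
    intro δ h0 h1
    have hlog : 0 < -Real.log δ := neg_pos.2 (Real.log_neg h0 h1)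
    have hV : (oscSum δ f).toReal ≤ C * δ ^ (1 - β) := by
      have h2 : oscSum δ f / ENNReal.ofReal (δ ^ (1 - β)) ≤ boxNorm β f :=
        (le_iSup₂ (f := fun (δ : ℝ) (_ : δ ∈ Set.Ioc (0 : ℝ) 1) =>
          oscSum δ f / ENNReal.ofReal (δ ^ (1 - β))) δ ⟨h0, h1.le⟩).trans le_add_self
      have hp : 0 < δ ^ (1 - β) := by positivity
      rw [ENNReal.div_le_iff (by simpa using hp) ENNReal.ofReal_ne_top] at h2
      have h3 := ENNReal.toReal_mono (ENNReal.mul_ne_top hf ENNReal.ofReal_ne_top) h2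
      rwa [ENNReal.toReal_mul, ENNReal.toReal_ofReal hp.le] at h3
    have hN : (boxCount δ (graph f) : ℝ) ≤ K * δ ^ (-β) := by
      refine (boxCount_le f h0).trans ?_
      rw [hK, mul_assoc]
      refine mul_le_mul_of_nonneg_left ?_ (by positivity)
      rw [add_mul]
      refine add_le_add ?_ ?_
      · rw [div_le_iff₀ h0]
        have h5 : δ ^ (1 - β) = δ * δ ^ (-β) := by
          rw [sub_eq_add_neg, Real.rpow_add h0, Real.rpow_one]
        rw [h5] at hV
        calc 2 * (oscSum δ f).toReal ≤ 2 * (C * (δ * δ ^ (-β))) := by linarith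
          _ = 2 * C * δ ^ (-β) * δ := by ring
      · rw [mul_assoc]
        refine mul_le_mul_of_nonneg_left ?_ (by norm_num)
        have h6 : (⌈δ⁻¹⌉₊ : ℝ) ≤ 2 * δ⁻¹ := by
          have := Nat.ceil_lt_add_one (inv_pos.2 h0).le
          have h7 : 1 ≤ δ⁻¹ := (one_le_inv₀ h0).2 h1.le
          linarith
        calc (⌈δ⁻¹⌉₊ : ℝ) ^ d ≤ (2 * δ⁻¹) ^ d := pow_le_pow_left₀ (by positivity) h6 d
          _ = 2 ^ d * δ ^ (-(d : ℝ)) := by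
            rw [mul_pow, Real.rpow_neg h0.le, Real.rpow_natCast, inv_pow]
          _ ≤ 2 ^ d * δ ^ (-β) := by
            refine mul_le_mul_of_nonneg_left ?_ (by positivity)
            exact Real.rpow_le_rpow_of_exponent_ge h0 h1.le (by linarith)
    have hl : Real.log (boxCount δ (graph f)) ≤ Real.log K + β * -Real.log δ := by
      rcases (boxCount δ (graph f)).eq_zero_or_pos with h | h
      · rw [h]
        simp only [Nat.cast_zero, Real.log_zero]
        have := Real.log_nonneg hK1
        positivity
      · have h' : (0 : ℝ) < boxCount δ (graph f) := by exact_mod_cast h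
        refine (Real.log_le_log h' hN).trans (le_of_eq ?_)
        rw [Real.log_mul (by positivity) (by positivity), Real.log_rpow h0]
        ring
    rw [div_add' _ _ _ hlog.ne']
    exact div_le_div_of_nonneg_right hl hlog.le
  have hlim : Tendsto (fun δ : ℝ => Real.log K / -Real.log δ + β) (𝓝[>] 0) (𝓝 β) := by
    have h1 : Tendsto (fun δ : ℝ => -Real.log δ) (𝓝[>] 0) atTop :=
      tendsto_neg_atBot_atTop.comp Real.tendsto_log_nhdsGT_zero
    simpa using (h1.const_div_atTop (Real.log K)).add_const β
  have hlim' : Tendsto (fun δ : ℝ => ((Real.log K / -Real.log δ + β : ℝ) : EReal)) (𝓝[>] 0)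
      (𝓝 (β : EReal)) := (continuous_coe_real_ereal.tendsto β).comp hlim
  rw [← hlim'.limsup_eq]
  refine limsup_le_limsup ?_
  have hev1 : ∀ᶠ δ : ℝ in 𝓝[>] 0, δ < 1 := eventually_nhdsWithin_of_eventually_nhds
    (eventually_lt_nhds one_pos)
  filter_upwards [hev1, self_mem_nhdsWithin] with δ h1 h0
  exact EReal.coe_le_coe_iff.2 (hbound δ h0 h1)

lemma upperBoxDim_le_iff {d : ℕ} {f : CCube d} {α : ℝ} (hα : (d : ℝ) ≤ α) :
    upperBoxDim (graph f) ≤ (α : EReal) ↔ ∀ k : ℕ, boxNorm (α + 1 / ((k : ℝ) + 1)) f ≠ ⊤ := by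
  constructor
  · intro h k
    exact boxNorm_ne_top ((Nat.cast_nonneg d).trans hα)
      (lt_add_of_pos_right α Nat.one_div_pos_of_nat) h
  · intro h
    have hlim : Tendsto (fun k : ℕ => ((α + 1 / ((k : ℝ) + 1) : ℝ) : EReal)) atTop
        (𝓝 (α : EReal)) := by
      refine (continuous_coe_real_ereal.tendsto α).comp ?_
      simpa using tendsto_one_div_add_atTop_nhds_zero_nat.const_add α
    refine ge_of_tendsto' hlim fun k => upperBoxDim_le_of_boxNorm ?_ (h k)
    exact hα.trans (lt_add_of_pos_right α Nat.one_div_pos_of_nat).le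

lemma osc_add_le {d : ℕ} (f g : CCube d) (S : Set (Fin d → I)) :
    osc (f + g) S ≤ osc f S + osc g S := by
  rw [osc_le_iff]
  intro x hx y hy
  refine le_trans ?_ (add_le_add (ofReal_abs_le_osc f hx hy) (ofReal_abs_le_osc g hx hy))
  rw [← ENNReal.ofReal_add (abs_nonneg _) (abs_nonneg _)]
  refine ENNReal.ofReal_le_ofReal ?_
  rw [ContinuousMap.add_apply, ContinuousMap.add_apply, add_sub_add_comm]
  exact abs_add_le _ _

lemma osc_smul_le {d : ℕ} (c : ℝ) (f : CCube d) (S : Set (Fin d → I)) :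
    osc (c • f) S ≤ ENNReal.ofReal |c| * osc f S := by
  rw [osc_le_iff]
  intro x hx y hy
  refine le_trans (le_of_eq ?_) (mul_le_mul_right (ofReal_abs_le_osc f hx hy) _)
  rw [← ENNReal.ofReal_mul (abs_nonneg _), ← abs_mul, mul_sub]
  rfl

lemma boxNorm_add_le {d : ℕ} (β : ℝ) (f g : CCube d) :
    boxNorm β (f + g) ≤ boxNorm β f + boxNorm β g := by
  unfold boxNorm
  rw [add_add_add_comm, ← ENNReal.ofReal_add (norm_nonneg _) (norm_nonneg _)]
  refine add_le_add (ENNReal.ofReal_le_ofReal (norm_add_le _ _)) (iSup₂_le fun δ hδ => ?_)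
  refine le_trans ?_ (add_le_add
    (le_iSup₂ (f := fun (δ : ℝ) (_ : δ ∈ Set.Ioc (0 : ℝ) 1) =>
      oscSum δ f / ENNReal.ofReal (δ ^ (1 - β))) δ hδ)
    (le_iSup₂ (f := fun (δ : ℝ) (_ : δ ∈ Set.Ioc (0 : ℝ) 1) =>
      oscSum δ g / ENNReal.ofReal (δ ^ (1 - β))) δ hδ))
  rw [← ENNReal.add_div]
  refine ENNReal.div_le_div_right ?_ _
  unfold oscSum
  rw [← Finset.sum_add_distrib]
  exact Finset.sum_le_sum fun n _ => osc_add_le f g _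

lemma boxNorm_smul_le {d : ℕ} (β c : ℝ) (f : CCube d) :
    boxNorm β (c • f) ≤ ENNReal.ofReal |c| * boxNorm β f := by
  unfold boxNorm
  rw [mul_add, ← ENNReal.ofReal_mul (abs_nonneg _)]
  refine add_le_add (le_of_eq (by rw [norm_smul, Real.norm_eq_abs])) (iSup₂_le fun δ hδ => ?_)
  refine le_trans ?_ (mul_le_mul_right (le_iSup₂ (f := fun (δ : ℝ) (_ : δ ∈ Set.Ioc (0 : ℝ) 1) =>
      oscSum δ f / ENNReal.ofReal (δ ^ (1 - β))) δ hδ) _)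
  rw [← mul_div_assoc]
  refine ENNReal.div_le_div_right ?_ _
  unfold oscSum
  rw [Finset.mul_sum]
  exact Finset.sum_le_sum fun n _ => osc_smul_le c f _

lemma boxNorm_zero {d : ℕ} (β : ℝ) : boxNorm β (0 : CCube d) = 0 := by
  have h := boxNorm_smul_le β 0 (0 : CCube d)
  simpa using h

lemma boxNorm_neg {d : ℕ} (β : ℝ) (f : CCube d) : boxNorm β (-f) = boxNorm β f := by
  have h : ∀ g : CCube d, boxNorm β (-g) ≤ boxNorm β g := fun g => by
    have h := boxNorm_smul_le β (-1) g
    simpa using h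
  refine le_antisymm (h f) ?_
  simpa using h (-f)

lemma ofReal_norm_le_boxNorm {d : ℕ} (β : ℝ) (f : CCube d) :
    ENNReal.ofReal ‖f‖ ≤ boxNorm β f := le_self_add

lemma lowerSemicontinuous_boxNorm {d : ℕ} (β : ℝ) :
    LowerSemicontinuous (boxNorm β : CCube d → ℝ≥0∞) := by
  unfold boxNorm
  refine LowerSemicontinuous.add
    (ENNReal.continuous_ofReal.comp continuous_norm).lowerSemicontinuous ?_
  refine lowerSemicontinuous_biSup fun δ hδ => ?_
  have h : LowerSemicontinuous (fun f : CCube d => oscSum δ f) := by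
    unfold oscSum
    refine lowerSemicontinuous_sum fun n _ => ?_
    unfold osc
    refine lowerSemicontinuous_biSup fun x _ => lowerSemicontinuous_biSup fun y _ => ?_
    refine Continuous.lowerSemicontinuous (ENNReal.continuous_ofReal.comp ?_)
    exact ((continuous_eval_const x).sub
      (continuous_eval_const y)).abs
  have hp : 0 < δ ^ (1 - β) := Real.rpow_pos_of_pos hδ.1 _
  have hc : Continuous fun a : ℝ≥0∞ => a / ENNReal.ofReal (δ ^ (1 - β)) :=
    ENNReal.continuous_div_const _ (by simpa using hp)
  exact hc.comp_lowerSemicontinuous h fun a b hab => ENNReal.div_le_div_right hab _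

/-! #### The metrics `d_{α,d}` -/

lemma boxEDist_self {d : ℕ} (α : ℝ) (f : CCube d) : boxEDist α f f = 0 := by
  simp [boxEDist, boxNorm_zero]

lemma boxEDist_comm {d : ℕ} (α : ℝ) (f g : CCube d) : boxEDist α f g = boxEDist α g f := by
  unfold boxEDist
  refine tsum_congr fun k => ?_
  rw [← boxNorm_neg, neg_sub]

lemma min_add_le_aux (a b c : ℝ≥0∞) : min a (b + c) ≤ min a b + min a c := by
  rcases le_total a b with h | h
  · rw [min_eq_left h]; exact (min_le_left _ _).trans le_self_add
  rcases le_total a c with h' | h'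
  · rw [min_eq_left h']; exact (min_le_left _ _).trans le_add_self
  · rw [min_eq_right h, min_eq_right h']; exact min_le_right _ _

lemma boxEDist_triangle {d : ℕ} (α : ℝ) (f g h : CCube d) :
    boxEDist α f h ≤ boxEDist α f g + boxEDist α g h := by
  unfold boxEDist
  rw [← ENNReal.tsum_add]
  refine ENNReal.tsum_le_tsum fun k => ?_
  refine le_trans (min_le_min le_rfl ?_) (min_add_le_aux _ _ _)
  have := boxNorm_add_le (α + 1 / ((k : ℝ) + 1)) (f - g) (g - h)
  rwa [sub_add_sub_cancel] at this

lemma boxEDist_ne_top {d : ℕ} (α : ℝ) (f g : CCube d) : boxEDist α f g ≠ ⊤ := by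
  refine ne_top_of_le_ne_top (b := ∑' k : ℕ, (2 : ℝ≥0∞)⁻¹ ^ (k + 1)) ?_
    (ENNReal.tsum_le_tsum fun k => min_le_left _ _)
  rw [ENNReal.tsum_geometric_add_one, ENNReal.one_sub_inv_two]
  finiteness

lemma min_le_boxEDist {d : ℕ} (α : ℝ) (f g : CCube d) (k : ℕ) :
    min ((2 : ℝ≥0∞)⁻¹ ^ (k + 1)) (boxNorm (α + 1 / ((k : ℝ) + 1)) (f - g)) ≤ boxEDist α f g :=
  ENNReal.le_tsum k

lemma two_inv_pow_ne_zero (k : ℕ) : (2 : ℝ≥0∞)⁻¹ ^ k ≠ 0 :=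
  pow_ne_zero _ (ENNReal.inv_ne_zero.2 (by finiteness))

lemma eq_of_boxEDist_eq_zero {d : ℕ} {α : ℝ} {f g : CCube d} (h : boxEDist α f g = 0) :
    f = g := by
  have h0 := min_le_boxEDist α f g 0
  rw [h] at h0
  have h1 := (min_le_iff.1 h0).resolve_left (not_le.2 (pos_iff_ne_zero.2 (two_inv_pow_ne_zero _)))
  have h2 := (ofReal_norm_le_boxNorm _ _).trans h1
  rw [nonpos_iff_eq_zero, ENNReal.ofReal_eq_zero] at h2
  exact sub_eq_zero.1 (norm_le_zero_iff.1 h2)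

lemma lowerSemicontinuous_boxEDist {d : ℕ} (α : ℝ) (g : CCube d) :
    LowerSemicontinuous fun f : CCube d => boxEDist α f g := by
  unfold boxEDist
  refine lowerSemicontinuous_tsum fun k => ?_
  refine LowerSemicontinuous.inf continuous_const.lowerSemicontinuous ?_
  exact (lowerSemicontinuous_boxNorm _).comp (continuous_id.sub continuous_const)

/-! ### The spaces `C_α[0,1]^d` -/

/-- `{f ∈ C[0,1]^d : upper box dimension of the graph of f is at most α}`, as a vector space. -/
def boxSubmodule (d : ℕ) (α : ℝ) (hα : (d : ℝ) ≤ α) : Submodule ℝ (CCube d) where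
  carrier := {f | upperBoxDim (graph f) ≤ (α : EReal)}
  zero_mem' := by
    rw [Set.mem_ofPred_eq, upperBoxDim_le_iff hα]
    intro k
    rw [boxNorm_zero]
    exact ENNReal.zero_ne_top
  add_mem' := by
    intro f g hf hg
    rw [Set.mem_ofPred_eq, upperBoxDim_le_iff hα] at *
    exact fun k => ne_top_of_le_ne_top (ENNReal.add_ne_top.2 ⟨hf k, hg k⟩) (boxNorm_add_le _ f g)
  smul_mem' := by
    intro c f hf
    rw [Set.mem_ofPred_eq, upperBoxDim_le_iff hα] at *
    exact fun k => ne_top_of_le_ne_top (ENNReal.mul_ne_top ENNReal.ofReal_ne_top (hf k))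
      (boxNorm_smul_le _ c f)

/-- The vector space `C_α[0,1]^d`, which is given the metric `d_{α,d}` below
(not the supremum metric). -/
def BoxSpace (d : ℕ) (α : ℝ) (hα : (d : ℝ) ≤ α) : Type := boxSubmodule d α hα

namespace BoxSpace

variable {d : ℕ} {α : ℝ} {hα : (d : ℝ) ≤ α}

instance : AddCommGroup (BoxSpace d α hα) := inferInstanceAs (AddCommGroup (boxSubmodule d α hα))

instance : Module ℝ (BoxSpace d α hα) := inferInstanceAs (Module ℝ (boxSubmodule d α hα))

/-- The inclusion of `C_α[0,1]^d` in `C[0,1]^d`. -/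
def toC (f : BoxSpace d α hα) : CCube d := Subtype.val (p := (· ∈ boxSubmodule d α hα)) f

lemma toC_injective : Function.Injective (toC : BoxSpace d α hα → CCube d) :=
  Subtype.val_injective

lemma toC_add (f g : BoxSpace d α hα) : (f + g).toC = f.toC + g.toC := rfl

lemma toC_sub (f g : BoxSpace d α hα) : (f - g).toC = f.toC - g.toC := rfl

lemma toC_smul (c : ℝ) (f : BoxSpace d α hα) : (c • f).toC = c • f.toC := rfl

lemma toC_zero : (0 : BoxSpace d α hα).toC = 0 := rfl

/-- The metric `d_{α,d}` on `C_α[0,1]^d`. -/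
noncomputable instance : MetricSpace (BoxSpace d α hα) where
  dist f g := (boxEDist α f.toC g.toC).toReal
  dist_self f := by rw [boxEDist_self, ENNReal.toReal_zero]
  dist_comm f g := by rw [boxEDist_comm]
  dist_triangle f g h := by
    rw [← ENNReal.toReal_add (boxEDist_ne_top _ _ _) (boxEDist_ne_top _ _ _)]
    exact ENNReal.toReal_mono (ENNReal.add_ne_top.2 ⟨boxEDist_ne_top _ _ _, boxEDist_ne_top _ _ _⟩)
      (boxEDist_triangle _ _ _ _)
  eq_of_dist_eq_zero {f g} h := toC_injective (eq_of_boxEDist_eq_zero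
    (((ENNReal.toReal_eq_zero_iff _).1 h).resolve_right (boxEDist_ne_top _ _ _)))

lemma dist_def (f g : BoxSpace d α hα) : dist f g = (boxEDist α f.toC g.toC).toReal := rfl

lemma edist_def (f g : BoxSpace d α hα) : edist f g = boxEDist α f.toC g.toC := by
  rw [edist_dist, dist_def, ENNReal.ofReal_toReal (boxEDist_ne_top _ _ _)]

lemma mem_iff (f : CCube d) : f ∈ boxSubmodule d α hα ↔
    ∀ k : ℕ, boxNorm (α + 1 / ((k : ℝ) + 1)) f ≠ ⊤ := upperBoxDim_le_iff hα

lemma boxNorm_toC_ne_top (f : BoxSpace d α hα) (k : ℕ) :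
    boxNorm (α + 1 / ((k : ℝ) + 1)) f.toC ≠ ⊤ := (mem_iff f.toC).1 f.2 k

lemma edist_add_add_le (f g f' g' : BoxSpace d α hα) :
    edist (f + g) (f' + g') ≤ edist f f' + edist g g' := by
  refine (edist_triangle _ (f' + g) _).trans (le_of_eq ?_)
  simp only [edist_def, boxEDist, toC_add, add_sub_add_right_eq_sub, add_sub_add_left_eq_sub]

instance : IsTopologicalAddGroup (BoxSpace d α hα) where
  continuous_add := by
    refine LipschitzWith.continuous (K := 2) fun p q => ?_
    refine (edist_add_add_le p.1 p.2 q.1 q.2).trans ?_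
    rw [ENNReal.coe_ofNat, two_mul]
    exact add_le_add (le_max_left _ _) (le_max_right _ _)
  continuous_neg := by
    refine LipschitzWith.continuous (K := 1) fun f g => ?_
    have h : edist (-f) (-g) = edist f g := by
      have h1 : ∀ k : ℕ, boxNorm (α + 1 / ((k : ℝ) + 1)) ((-f).toC - (-g).toC) =
          boxNorm (α + 1 / ((k : ℝ) + 1)) (f.toC - g.toC) := fun k => by
        rw [← boxNorm_neg]
        congr 1
        change -(-f.toC - -g.toC) = _
        abel
      simp only [edist_def, boxEDist, h1]
    rw [h, ENNReal.coe_one, one_mul]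

lemma edist_smul_zero_le (c : ℝ) (f : BoxSpace d α hα) :
    edist (c • f) 0 ≤ ENNReal.ofReal (max 1 |c|) * edist f 0 := by
  simp only [edist_def, boxEDist, toC_smul, toC_zero, sub_zero]
  rw [← ENNReal.tsum_mul_left]
  refine ENNReal.tsum_le_tsum fun k => ?_
  have h1 : (1 : ℝ≥0∞) ≤ ENNReal.ofReal (max 1 |c|) := by
    rw [← ENNReal.ofReal_one]; exact ENNReal.ofReal_le_ofReal (le_max_left _ _)
  rcases le_total ((2 : ℝ≥0∞)⁻¹ ^ (k + 1)) (boxNorm (α + 1 / ((k : ℝ) + 1)) f.toC) with h | h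
  · rw [min_eq_left h]
    exact (min_le_left _ _).trans (le_mul_of_one_le_left zero_le h1)
  · rw [min_eq_right h]
    exact (min_le_right _ _).trans ((boxNorm_smul_le _ _ _).trans
      (mul_le_mul_left (ENNReal.ofReal_le_ofReal (le_max_right _ _)) _))

lemma tendsto_smul_left (f : BoxSpace d α hα) :
    Tendsto (fun c : ℝ => c • f) (𝓝 0) (𝓝 0) := by
  rw [tendsto_iff_dist_tendsto_zero]
  have h : ∀ c : ℝ, dist (c • f) 0 = ∑' k : ℕ, (min ((2 : ℝ≥0∞)⁻¹ ^ (k + 1))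
      (boxNorm (α + 1 / ((k : ℝ) + 1)) (c • f.toC))).toReal := fun c => by
    rw [dist_def, boxEDist, ENNReal.tsum_toReal_eq]
    · simp only [toC_smul, toC_zero, sub_zero]
    · exact fun k => ne_top_of_le_ne_top (by finiteness) (min_le_left _ _)
  simp only [h]
  have h0 : 𝓝 (∑' _ : ℕ, (0 : ℝ)) = 𝓝 0 := by rw [tsum_zero]
  refine Tendsto.mono_right ?_ h0.le
  refine tendsto_tsum_of_dominated_convergence (bound := fun k : ℕ => (2 : ℝ)⁻¹ ^ (k + 1)) ?_ ?_ ?_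
  · exact (summable_nat_add_iff 1).2
      (summable_geometric_of_lt_one (by norm_num) (by norm_num : (2 : ℝ)⁻¹ < 1))
  · intro k
    rw [← ENNReal.toReal_zero]
    refine (ENNReal.tendsto_toReal ENNReal.zero_ne_top).comp ?_
    have hb : Tendsto (fun c : ℝ => ENNReal.ofReal |c| * boxNorm (α + 1 / ((k : ℝ) + 1)) f.toC)
        (𝓝 (0 : ℝ)) (𝓝 0) := by
      have h1 : Tendsto (fun c : ℝ => ENNReal.ofReal |c|) (𝓝 0) (𝓝 0) := by
        have := (ENNReal.continuous_ofReal.comp continuous_abs).tendsto (0 : ℝ)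
        simpa [Function.comp_def] using this
      simpa using ENNReal.Tendsto.mul_const h1 (Or.inr (boxNorm_toC_ne_top f k))
    exact tendsto_of_tendsto_of_tendsto_of_le_of_le tendsto_const_nhds hb (fun _ => zero_le)
      fun c => (min_le_right _ _).trans (boxNorm_smul_le _ _ _)
  · refine Eventually.of_forall fun c k => ?_
    rw [Real.norm_of_nonneg ENNReal.toReal_nonneg]
    have h1 := ENNReal.toReal_mono (a := min ((2 : ℝ≥0∞)⁻¹ ^ (k + 1))
      (boxNorm (α + 1 / ((k : ℝ) + 1)) (c • f.toC))) (by finiteness) (min_le_left _ _)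
    simpa using h1

instance : ContinuousSMul ℝ (BoxSpace d α hα) := by
  refine ContinuousSMul.of_nhds_zero ?_ tendsto_smul_left ?_
  · rw [tendsto_iff_edist_tendsto_0]
    have hz : Tendsto (fun p : ℝ × BoxSpace d α hα => edist p.2 0) (𝓝 0 ×ˢ 𝓝 0) (𝓝 0) :=
      (tendsto_iff_edist_tendsto_0.1 tendsto_id).comp tendsto_snd
    refine tendsto_of_tendsto_of_tendsto_of_le_of_le' tendsto_const_nhds hz
      (Eventually.of_forall fun _ => zero_le) ?_
    have h1 : ∀ᶠ p : ℝ × BoxSpace d α hα in 𝓝 0 ×ˢ 𝓝 0, |p.1| < 1 := by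
      have h2 : ∀ᶠ c : ℝ in 𝓝 0, |c| < 1 :=
        (continuous_abs.tendsto (0 : ℝ)).eventually (gt_mem_nhds (by simp))
      exact tendsto_fst.eventually h2
    filter_upwards [h1] with p hp
    have := edist_smul_zero_le p.1 p.2
    rwa [max_eq_left hp.le, ENNReal.ofReal_one, one_mul] at this
  · intro c
    rw [tendsto_iff_edist_tendsto_0]
    have hz : Tendsto (fun f : BoxSpace d α hα => ENNReal.ofReal (max 1 |c|) * edist f 0)
        (𝓝 0) (𝓝 0) := by
      have := ENNReal.Tendsto.const_mul (a := ENNReal.ofReal (max 1 |c|))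
        (tendsto_iff_edist_tendsto_0.1 (tendsto_id (x := 𝓝 (0 : BoxSpace d α hα))))
        (Or.inr ENNReal.ofReal_ne_top)
      simpa using this
    exact tendsto_of_tendsto_of_tendsto_of_le_of_le tendsto_const_nhds hz (fun _ => zero_le)
      fun f => edist_smul_zero_le c f

lemma uniformContinuous_toC : UniformContinuous (toC : BoxSpace d α hα → CCube d) := by
  rw [EMetric.uniformContinuous_iff]
  intro ε hε
  refine ⟨min ((2 : ℝ≥0∞)⁻¹ ^ (0 + 1)) ε,
    lt_min (pos_iff_ne_zero.2 (two_inv_pow_ne_zero _)) hε, fun {f g} h => ?_⟩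
  rw [edist_def] at h
  have h1 := lt_of_le_of_lt (min_le_boxEDist α f.toC g.toC 0) h
  rw [edist_dist, dist_eq_norm]
  refine lt_of_le_of_lt (ofReal_norm_le_boxNorm (α + 1 / (((0 : ℕ) : ℝ) + 1)) _) ?_
  rcases min_lt_iff.1 (lt_of_lt_of_le h1 (min_le_left _ _)) with h2 | h2
  · exact absurd h2 (lt_irrefl _)
  · rcases min_lt_iff.1 (lt_of_lt_of_le h1 (min_le_right _ _)) with h3 | h3
    · exact (h2.trans h3)
    · exact h3

instance : CompleteSpace (BoxSpace d α hα) := by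
  refine EMetric.complete_of_cauchySeq_tendsto fun u hu => ?_
  obtain ⟨F, hF⟩ := cauchySeq_tendsto_of_complete (uniformContinuous_toC.comp_cauchySeq hu)
  have hclose : ∀ ε : ℝ≥0∞, 0 < ε → ∃ N, ∀ n ≥ N, boxEDist α F (u n).toC ≤ ε := by
    intro ε hε
    obtain ⟨N, hN⟩ := EMetric.cauchySeq_iff.1 hu ε hε
    refine ⟨N, fun n hn => ?_⟩
    have hcl := (lowerSemicontinuous_boxEDist α (u n).toC).isClosed_preimage ε
    refine hcl.mem_of_tendsto hF ?_
    filter_upwards [eventually_ge_atTop N] with m hm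
    have := (hN m hm n hn).le
    rwa [edist_def] at this
  have hmem : F ∈ boxSubmodule d α hα := by
    rw [mem_iff]
    intro k
    obtain ⟨N, hN⟩ := hclose ((2 : ℝ≥0∞)⁻¹ ^ (k + 1) / 2)
      (ENNReal.half_pos (two_inv_pow_ne_zero _))
    have h1 := (min_le_boxEDist α F (u N).toC k).trans (hN N le_rfl)
    have h2 : (2 : ℝ≥0∞)⁻¹ ^ (k + 1) / 2 < (2 : ℝ≥0∞)⁻¹ ^ (k + 1) :=
      ENNReal.half_lt_self (two_inv_pow_ne_zero _) (by finiteness)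
    have h3 := (min_le_iff.1 h1).resolve_left (not_le.2 h2)
    have h4 := boxNorm_add_le (α + 1 / ((k : ℝ) + 1)) (F - (u N).toC) (u N).toC
    rw [sub_add_cancel] at h4
    exact ne_top_of_le_ne_top (ENNReal.add_ne_top.2
      ⟨ne_top_of_le_ne_top (h2.ne_top) h3, boxNorm_toC_ne_top _ k⟩) h4
  let G : BoxSpace d α hα := (⟨F, hmem⟩ : boxSubmodule d α hα)
  refine ⟨G, EMetric.tendsto_atTop.2 fun ε hε => ?_⟩
  obtain ⟨N, hN⟩ := hclose (min 1 ε / 2) (ENNReal.half_pos (lt_min one_pos hε).ne')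
  refine ⟨N, fun n hn => ?_⟩
  rw [edist_comm, edist_def]
  refine lt_of_le_of_lt (hN n hn) (lt_of_lt_of_le (ENNReal.half_lt_self
    (lt_min one_pos hε).ne' ?_) (min_le_right _ _))
  exact ne_top_of_le_ne_top ENNReal.one_ne_top (min_le_left _ _)

end BoxSpace

/-! ### Prevalence -/

section Prevalence

variable {X : Type*} [AddCommGroup X] [Module ℝ X]

/-- The `k`-dimensional Lebesgue measure on a subspace `P` of `X` (in the coordinates given by a
basis of `P`), evaluated at a subset `A` of `X`, i.e. the measure of `A ∩ P`. Another basis of `P`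
changes it by a positive constant factor. -/
noncomputable def subspaceLebesgue {k : ℕ} {P : Submodule ℝ X} (b : Module.Basis (Fin k) ℝ P)
    (A : Set X) : ℝ≥0∞ :=
  volume {t : Fin k → ℝ | ((∑ i, t i • b i : P) : X) ∈ A}

/-- The `k`-dimensional subspace `P` is a probe for `F`: for every `x`, Lebesgue-almost every
point of `P` lies in `F + x`. -/
def IsProbe (k : ℕ) (P : Submodule ℝ X) (F : Set X) : Prop :=
  ∃ b : Module.Basis (Fin k) ℝ P, ∀ x : X, subspaceLebesgue b ((fun y => y + x) '' F)ᶜ = 0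

/-- A subset `F` of a completely metrizable topological vector space `X` is `k`-prevalent if it is
a Borel set and has a `k`-dimensional probe. -/
def IsKPrevalent [TopologicalSpace X] [IsTopologicalAddGroup X] [ContinuousSMul ℝ X]
    [TopologicalSpace.IsCompletelyMetrizableSpace X] (k : ℕ) (F : Set X) : Prop :=
  MeasurableSet[borel X] F ∧ ∃ P : Submodule ℝ X, IsProbe k P F

end Prevalence

/-! ### The sets of surfaces -/

/-- `F_α[0,1]^2`: the surfaces of box dimension `α` whose horizon has lower and upper box
dimensions between `α - 1` and `2`. -/
def surfaces (α : ℝ) : Set (CCube 2) :=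
  {f | upperBoxDim (graph f) ≤ (α : EReal) ∧ HasBoxDim (graph f) (α : EReal) ∧
    ((α - 1 : ℝ) : EReal) ≤ lowerBoxDim (graph (horizon f)) ∧
    lowerBoxDim (graph (horizon f)) ≤ upperBoxDim (graph (horizon f)) ∧
    upperBoxDim (graph (horizon f)) ≤ 2}

end Horizon

namespace Horizon

/-! ### Box counts on dyadic meshes -/

/-! The probe is the line spanned by a ridge `φ(x, y) = τ(x)`, where `τ` is a Takagi-type function
of Hölder exponent `s = 3 - α`. A function of `x` alone passes through the supremum over `y`, so
`H(f + tφ) = H(f) + tτ` (`horizon_add_smul_ridge`). Hence a line of surfaces in direction `φ` has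
horizons on a line in direction `τ`, and one argument serves both.

That argument is `ae_le_lowerBoxDim`. Write `V_δ` for the sum of ranges over the `δ`-mesh; it is at
most `δ N_δ` of the graph. By subadditivity `|t - u| V_δ(φ) ≤ V_δ(f + tφ) + V_δ(f + uφ)`. If `t` and
`u` both give fewer than `2^(n(β - ε))` boxes at scale `2^(-n)`, while `V_δ(φ)` is at least `2^(n(β
- 1))` up to a polynomial factor, then `|t - u|` is at most a polynomial times `2^(-εn)`. The bad
parameters at level `n` thus form a set of summable diameter, and Borel–Cantelli gives lower
dimension at least `β` for almost every `t`. Here `β = 3 - s = α` for the surface and `β = 2 - s = α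
- 1` for the horizon.

The lower bound for `V_δ(φ)` comes from second differences of `τ` on dyadic intervals
(`amplitude_le_takagi`). The upper bounds are cheap: the graph of a continuous function on the
`d`-cube has dimension at most `d + 1`, and Hölder continuity puts `φ` in the vector space `C_α`,
which then contains the whole line through each of its members.

Borel measurability rests on reducing both dimensions to countably many conditions: dyadic box
counts for the lower one (`le_lowerBoxDim_iff`), finiteness of lower semicontinuous norms for the
upper one. -/

lemma boxCount_le_of_le {k : ℕ} {F : Set (Fin k → ℝ)} {δ D : ℝ} (hδ : 0 < δ) (hD : δ ≤ D)
    (hF : {m : Fin k → ℤ | (meshCube δ m ∩ F).Nonempty}.Finite) :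
    boxCount D F ≤ 3 ^ k * boxCount δ F := by
  classical
  have hD0 : 0 < D := hδ.trans_le hD
  -- The indices of the closed `D`-cubes that can touch the `δ`-cube `p`.
  let T : (Fin k → ℤ) → Finset (Fin k → ℤ) := fun p =>
    Finset.Icc (fun i => ⌈(p i : ℝ) * δ / D - 1⌉) (fun i => ⌊((p i : ℝ) + 1) * δ / D⌋)
  have hsub : {m : Fin k → ℤ | (meshCube D m ∩ F).Nonempty} ⊆ (hF.toFinset.biUnion T : Set _) := by
    rintro m ⟨x, hx, hxF⟩
    have hp : x ∈ meshCube δ fun i => ⌊x i / δ⌋ := fun i =>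
      ⟨(le_div_iff₀ hδ).1 (Int.floor_le _), (div_le_iff₀ hδ).1 (Int.lt_floor_add_one _).le⟩
    simp only [Finset.coe_biUnion, Set.Finite.coe_toFinset, Set.mem_iUnion]
    refine ⟨_, ⟨x, hp, hxF⟩, ?_⟩
    simp only [T, Finset.coe_Icc]
    refine ⟨fun i => ?_, fun i => ?_⟩
    · rw [Int.ceil_le, sub_le_iff_le_add, div_le_iff₀ hD0]
      exact (hp i).1.trans (hx i).2
    · rw [Int.le_floor, le_div_iff₀ hD0]
      exact (hx i).1.trans (hp i).2
  have hT : ∀ p, (T p).card ≤ 3 ^ k := by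
    intro p
    simp only [T, Pi.card_Icc, Int.card_Icc]
    refine (Finset.prod_le_pow_card _ _ 3 fun i _ => ?_).trans (by simp)
    rw [Int.toNat_le]
    have h1 := Int.floor_le (((p i : ℝ) + 1) * δ / D)
    have h2 := Int.le_ceil ((p i : ℝ) * δ / D - 1)
    have h3 : δ / D ≤ 1 := (div_le_one hD0).2 hD
    -- In each coordinate the indices lie in an interval of length `1 + δ / D ≤ 2`, which holds at
    -- most three integers.
    have h4 : ((p i : ℝ) + 1) * δ / D = (p i : ℝ) * δ / D + δ / D := by ring
    have h5 : ((⌊((p i : ℝ) + 1) * δ / D⌋ + 1 - ⌈(p i : ℝ) * δ / D - 1⌉ : ℤ) : ℝ) ≤ (3 : ℤ) := by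
      push_cast; linarith
    exact_mod_cast h5
  have h1 := Set.ncard_le_ncard hsub (Finset.finite_toSet _)
  rw [Set.ncard_coe_finset] at h1
  refine h1.trans (Finset.card_biUnion_le.trans ((Finset.sum_le_card_nsmul _ _ _ fun p _ => hT p).trans
    (le_of_eq ?_)))
  rw [boxCount, Set.ncard_eq_toFinset_card _ hF, smul_eq_mul, mul_comm]

lemma log_boxCount_le_of_le {k : ℕ} {F : Set (Fin k → ℝ)} {δ D : ℝ} (hδ : 0 < δ) (hD : δ ≤ D)
    (hF : {m : Fin k → ℤ | (meshCube δ m ∩ F).Nonempty}.Finite) :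
    Real.log (boxCount D F) ≤ k * Real.log 3 + Real.log (boxCount δ F) := by
  have h := boxCount_le_of_le hδ hD hF
  rcases (boxCount D F).eq_zero_or_pos with h0 | h0
  · rw [h0, Nat.cast_zero, Real.log_zero]
    have h3 : 0 ≤ Real.log 3 := Real.log_nonneg (by norm_num)
    have := Real.log_natCast_nonneg (boxCount δ F)
    positivity
  · have h1 : 0 < boxCount δ F := by
      rcases (boxCount δ F).eq_zero_or_pos with h2 | h2
      · simp [h2] at h; omega
      · exact h2
    have h2 : (boxCount D F : ℝ) ≤ 3 ^ k * boxCount δ F := by exact_mod_cast h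
    refine (Real.log_le_log (by exact_mod_cast h0) h2).trans (le_of_eq ?_)
    rw [Real.log_mul (by positivity) (by exact_mod_cast h1.ne'), Real.log_pow]

lemma tendsto_neg_log_nhdsGT_zero : Tendsto (fun δ : ℝ => -Real.log δ) (𝓝[>] 0) atTop :=
  tendsto_neg_atBot_atTop.comp Real.tendsto_log_nhdsGT_zero

lemma eventually_lt_one_nhdsGT_zero : ∀ᶠ δ : ℝ in 𝓝[>] 0, δ < 1 :=
  eventually_nhdsWithin_of_eventually_nhds (eventually_lt_nhds one_pos)

/-- The lower box dimension is determined by the dyadic meshes. -/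
lemma le_lowerBoxDim_iff {d : ℕ} (f : CCube d) (β : ℝ) :
    (β : EReal) ≤ lowerBoxDim (graph f) ↔ ∀ j : ℕ, ∀ᶠ n : ℕ in atTop,
      (n : ℝ) * (β - 1 / ((j : ℝ) + 1)) * Real.log 2 ≤
        Real.log (boxCount ((2 : ℝ)⁻¹ ^ n) (graph f)) := by
  have hl2 : 0 < Real.log 2 := Real.log_pos (by norm_num)
  constructor
  · intro h j
    have hj : 0 < 1 / ((j : ℝ) + 1) := Nat.one_div_pos_of_nat
    have h1 : ((β - 1 / ((j : ℝ) + 1) : ℝ) : EReal) < lowerBoxDim (graph f) :=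
      lt_of_lt_of_le (EReal.coe_lt_coe_iff.2 (by linarith)) h
    have h2 := eventually_lt_of_lt_liminf h1
    have ht : Tendsto (fun n : ℕ => (2 : ℝ)⁻¹ ^ n) atTop (𝓝[>] 0) :=
      tendsto_nhdsWithin_iff.2 ⟨tendsto_pow_atTop_nhds_zero_of_lt_one (by norm_num) (by norm_num),
        Eventually.of_forall fun n => by simp⟩
    filter_upwards [ht.eventually h2, eventually_gt_atTop 0] with n hn hn0
    have h3 := EReal.coe_lt_coe_iff.1 hn
    have hn0' : (0 : ℝ) < n := by exact_mod_cast hn0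
    have h4 : -Real.log ((2 : ℝ)⁻¹ ^ n) = n * Real.log 2 := by
      rw [Real.log_pow, Real.log_inv]; ring
    rw [h4, lt_div_iff₀ (by positivity)] at h3
    linarith
  · intro h
    rw [← EReal.ge_of_forall_gt_iff_ge]
    intro c hc
    have hc := EReal.coe_lt_coe_iff.1 hc
    refine le_liminf_of_le (by isBoundedDefault) ?_
    -- Nonpositive `c` is trivial; positivity is used below to get `γ > 0`.
    rcases le_or_gt c 0 with hc0 | hc0
    · filter_upwards [eventually_lt_one_nhdsGT_zero, self_mem_nhdsWithin] with δ h1 h0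
      have hlog : 0 < -Real.log δ := neg_pos.2 (Real.log_neg h0 h1)
      refine EReal.coe_le_coe_iff.2 (hc0.trans ?_)
      exact div_nonneg (Real.log_natCast_nonneg _) hlog.le
    obtain ⟨j, hj⟩ := exists_nat_one_div_lt (half_pos (sub_pos.2 hc))
    set γ : ℝ := β - 1 / ((j : ℝ) + 1) with hγ
    have hγc : c + (β - c) / 2 < γ := by rw [hγ]; linarith
    have hγ0 : 0 < γ := by linarith
    obtain ⟨N, hN⟩ := eventually_atTop.1 (h j)
    -- The first bound makes the dyadic level `n` of `δ` at least `N`. The second lets the gain `(γ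
    -- - c) L` absorb both the rounding of `δ` up to `2^(-n)` and the factor `3^(d+1)` between the
    -- two meshes.
    have hL := tendsto_neg_log_nhdsGT_zero.eventually_ge_atTop
      (max ((N : ℝ) * Real.log 2) ((Real.log 2 * γ + ((d + 1 : ℕ) : ℝ) * Real.log 3) / (γ - c)))
    filter_upwards [eventually_lt_one_nhdsGT_zero, self_mem_nhdsWithin, hL] with δ h1 h0 hLδ
    have h0 : 0 < δ := h0
    set L := -Real.log δ with hLdef
    have hlog : 0 < L := neg_pos.2 (Real.log_neg h0 h1)
    refine EReal.coe_le_coe_iff.2 ?_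
    rw [le_div_iff₀ hlog]
    have hLN := (le_max_left _ _).trans hLδ
    have hLc := (le_max_right _ _).trans hLδ
    rw [div_le_iff₀ (by linarith)] at hLc
    set n := ⌊L / Real.log 2⌋₊ with hn
    have hn1 : (n : ℝ) * Real.log 2 ≤ L := by
      rw [← le_div_iff₀ hl2]; exact Nat.floor_le (by positivity)
    have hn2 : L ≤ ((n : ℝ) + 1) * Real.log 2 := by
      rw [← div_le_iff₀ hl2]; exact (Nat.lt_floor_add_one _).le
    have hNn : N ≤ n := Nat.le_floor ((le_div_iff₀ hl2).2 hLN)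
    have hδn : δ ≤ (2 : ℝ)⁻¹ ^ n := by
      rw [← Real.log_le_log_iff h0 (by positivity), Real.log_pow, Real.log_inv]
      linarith
    have h3 := log_boxCount_le_of_le h0 hδn (hit_finite f h0)
    have h4 := hN n hNn
    nlinarith

/-! ### Upper bounds for the upper box dimension -/

lemma lowerBoxDim_le_upperBoxDim {k : ℕ} (F : Set (Fin k → ℝ)) :
    lowerBoxDim F ≤ upperBoxDim F := liminf_le_limsup

lemma ceil_inv_le {δ : ℝ} (h : δ ∈ Set.Ioc (0 : ℝ) 1) : (⌈δ⁻¹⌉₊ : ℝ) ≤ 2 * δ⁻¹ := by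
  have h1 := Nat.ceil_lt_add_one (inv_pos.2 h.1).le
  have h2 : 1 ≤ δ⁻¹ := (one_le_inv₀ h.1).2 h.2
  linarith

/-- A function which varies by at most `C δ^s` on the cubes of each `δ`-mesh is in `V_{d+1-s}`. -/
lemma boxNorm_ne_top_of_osc_le {d : ℕ} {f : CCube d} {s C : ℝ} (hC : 0 ≤ C)
    (h : ∀ δ ∈ Set.Ioc (0 : ℝ) 1, ∀ n : Fin d → Fin ⌈δ⁻¹⌉₊,
      osc f (gridCube δ n) ≤ ENNReal.ofReal (C * δ ^ s)) :
    boxNorm (d + 1 - s) f ≠ ⊤ := by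
  unfold boxNorm
  refine ENNReal.add_ne_top.2 ⟨ENNReal.ofReal_ne_top,
    ne_top_of_le_ne_top (b := ENNReal.ofReal (2 ^ d * C)) ENNReal.ofReal_ne_top
      (iSup₂_le fun δ hδ => ?_)⟩
  refine ENNReal.div_le_of_le_mul ?_
  have hδ0 := hδ.1
  rw [← ENNReal.ofReal_mul (by positivity)]
  unfold oscSum
  refine (Finset.sum_le_card_nsmul _ _ _ fun n _ => h δ hδ n).trans ?_
  simp only [Finset.card_univ, Fintype.card_pi, Fintype.card_fin, Finset.prod_const, nsmul_eq_mul]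
  rw [← ENNReal.ofReal_natCast, ← ENNReal.ofReal_mul (Nat.cast_nonneg _)]
  refine ENNReal.ofReal_le_ofReal ?_
  have h1 : (⌈δ⁻¹⌉₊ : ℝ) ^ d ≤ 2 ^ d * δ ^ (-(d : ℝ)) := by
    refine (pow_le_pow_left₀ (by positivity) (ceil_inv_le hδ) d).trans (le_of_eq ?_)
    rw [mul_pow, Real.rpow_neg hδ0.le, Real.rpow_natCast, inv_pow]
  have h2 : δ ^ (1 - ((d : ℝ) + 1 - s)) = δ ^ (-(d : ℝ)) * δ ^ s := by
    rw [← Real.rpow_add hδ0]; congr 1; ring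
  push_cast
  rw [h2]
  calc (⌈δ⁻¹⌉₊ : ℝ) ^ d * (C * δ ^ s) ≤ 2 ^ d * δ ^ (-(d : ℝ)) * (C * δ ^ s) :=
        mul_le_mul_of_nonneg_right h1 (by positivity)
    _ = _ := by ring

/-- Boundedness of `f` is the case `s = 0` of the preceding range criterion. -/
lemma upperBoxDim_graph_le {d : ℕ} (f : CCube d) :
    upperBoxDim (graph f) ≤ ((d + 1 : ℝ) : EReal) := by
  have h : boxNorm (d + 1 - 0) f ≠ ⊤ := boxNorm_ne_top_of_osc_le (C := 2 * ‖f‖) (by positivity)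
    fun δ _ n => by simpa using osc_le_norm f _
  rw [sub_zero] at h
  exact upperBoxDim_le_of_boxNorm (by linarith) h

/-! ### Borel measurability -/

/-- The set is the projection, along the compact cube, of a closed set of pairs `(x, f)`; evaluation
is jointly continuous. -/
lemma isClosed_setOf_hit {d : ℕ} (δ : ℝ) (m : Fin (d + 1) → ℤ) :
    IsClosed {f : CCube d | (meshCube δ m ∩ graph f).Nonempty} := by
  have h : IsClosed {p : (Fin d → I) × CCube d |
      (∀ i : Fin d, (m i.castSucc : ℝ) * δ ≤ p.1 i ∧
        (p.1 i : ℝ) ≤ ((m i.castSucc : ℝ) + 1) * δ) ∧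
        (m (Fin.last d) : ℝ) * δ ≤ p.2 p.1 ∧ p.2 p.1 ≤ ((m (Fin.last d) : ℝ) + 1) * δ} := by
    have h1 : ∀ i : Fin d, Continuous fun p : (Fin d → I) × CCube d => (p.1 i : ℝ) := fun i =>
      continuous_subtype_val.comp ((continuous_apply i).comp continuous_fst)
    have h2 : Continuous fun p : (Fin d → I) × CCube d => p.2 p.1 :=
      continuous_eval.comp continuous_swap
    simp only [Set.ofPred_and, Set.ofPred_forall]
    exact (isClosed_iInter fun i => (isClosed_le continuous_const (h1 i)).inter
      (isClosed_le (h1 i) continuous_const)).inter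
      ((isClosed_le continuous_const h2).inter (isClosed_le h2 continuous_const))
  convert isClosedMap_snd_of_compactSpace _ h using 1
  ext f
  simp only [Set.mem_ofPred_eq, mem_hit_iff, Set.mem_image, Prod.exists, exists_eq_right]

section Measurability

variable {d : ℕ} [MeasurableSpace (CCube d)] [BorelSpace (CCube d)]

lemma measurable_boxCount {δ : ℝ} (hδ : 0 < δ) :
    Measurable fun f : CCube d => boxCount δ (graph f) := by
  refine measurable_of_Ici fun k => ?_
  -- At least `k` cubes are hit iff all cubes of some finite family of at least `k` are hit, and
  -- there are only countably many finite families.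
  have h : (fun f : CCube d => boxCount δ (graph f)) ⁻¹' Set.Ici k =
      ⋃ T ∈ {T : Finset (Fin (d + 1) → ℤ) | k ≤ T.card},
        ⋂ m ∈ T, {f : CCube d | (meshCube δ m ∩ graph f).Nonempty} := by
    ext f
    simp only [Set.mem_preimage, Set.mem_Ici, Set.mem_iUnion, Set.mem_iInter, Set.mem_ofPred_eq,
      exists_prop]
    constructor
    · intro hk
      refine ⟨(hit_finite f hδ).toFinset, ?_, fun m hm => by simpa using hm⟩
      rwa [← Set.ncard_eq_toFinset_card _ (hit_finite f hδ)]
    · rintro ⟨T, hT, hm⟩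
      refine hT.trans ?_
      rw [← Set.ncard_coe_finset]
      exact Set.ncard_le_ncard (fun m h => hm m h) (hit_finite f hδ)
  rw [h]
  exact MeasurableSet.biUnion (Set.to_countable _) fun T _ =>
    T.measurableSet_biInter fun m _ => (isClosed_setOf_hit δ m).measurableSet

lemma measurableSet_le_lowerBoxDim (β : ℝ) :
    MeasurableSet {f : CCube d | (β : EReal) ≤ lowerBoxDim (graph f)} := by
  simp only [le_lowerBoxDim_iff, eventually_atTop, Set.ofPred_forall, Set.ofPred_exists]
  refine MeasurableSet.iInter fun j => MeasurableSet.iUnion fun N => MeasurableSet.iInter fun n =>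
    MeasurableSet.iInter fun _ => ?_
  exact measurableSet_le measurable_const
    (Real.measurable_log.comp (measurable_from_top.comp (measurable_boxCount (by positivity))))

lemma measurableSet_upperBoxDim_le {α : ℝ} (hα : (d : ℝ) ≤ α) :
    MeasurableSet {f : CCube d | upperBoxDim (graph f) ≤ (α : EReal)} := by
  simp only [upperBoxDim_le_iff hα, Set.ofPred_forall]
  exact MeasurableSet.iInter fun k =>
    (measurableSet_singleton _).compl.preimage (lowerSemicontinuous_boxNorm _).measurable

end Measurability

/-! ### The horizon map -/

lemma bddAbove_range_section (f : CCube 2) (x : I) :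
    BddAbove (Set.range fun y : I => f ![x, y]) :=
  ⟨‖f‖, by rintro _ ⟨y, rfl⟩; exact (le_abs_self _).trans (f.norm_coe_le_norm _)⟩

lemma horizon_apply (f : CCube 2) (x : Fin 1 → I) : horizon f x = ⨆ y : I, f ![x 0, y] := rfl

lemma horizon_le_add (f g : CCube 2) (x : Fin 1 → I) :
    horizon f x ≤ horizon g x + ‖f - g‖ := by
  refine ciSup_le fun y => ?_
  have h1 := (le_abs_self _).trans ((f - g).norm_coe_le_norm ![x 0, y])
  have h2 := le_ciSup (bddAbove_range_section g (x 0)) y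
  rw [ContinuousMap.sub_apply] at h1
  rw [horizon_apply]
  linarith

lemma continuous_horizon : Continuous horizon := by
  refine LipschitzWith.continuous (K := 1) (LipschitzWith.of_dist_le_mul fun f g => ?_)
  rw [NNReal.coe_one, one_mul, ContinuousMap.dist_le dist_nonneg]
  intro x
  rw [Real.dist_eq, abs_sub_le_iff, dist_eq_norm]
  have h1 := horizon_le_add f g x
  have h2 := horizon_le_add g f x
  rw [norm_sub_rev] at h2
  constructor <;> linarith

/-- Only one upper and two lower bounds carry content: the others follow from `liminf ≤ limsup` and
from the horizon being a function of one variable. -/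
lemma mem_surfaces_iff {α : ℝ} {f : CCube 2} : f ∈ surfaces α ↔
    upperBoxDim (graph f) ≤ (α : EReal) ∧ (α : EReal) ≤ lowerBoxDim (graph f) ∧
      ((α - 1 : ℝ) : EReal) ≤ lowerBoxDim (graph (horizon f)) := by
  constructor
  · rintro ⟨h1, h2, h3, -⟩
    exact ⟨h1, h2.1.ge, h3⟩
  · rintro ⟨h1, h2, h3⟩
    have h4 := lowerBoxDim_le_upperBoxDim (graph f)
    refine ⟨h1, ⟨le_antisymm (h4.trans h1) h2, le_antisymm h1 (h2.trans h4)⟩, h3,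
      lowerBoxDim_le_upperBoxDim _, (upperBoxDim_graph_le _).trans (le_of_eq ?_)⟩
    norm_num
    rfl

lemma measurableSet_surfaces {α : ℝ} (hα : 2 ≤ α) :
    MeasurableSet[borel (CCube 2)] (surfaces α) := by
  borelize (CCube 2) (CCube 1)
  have h : surfaces α = {f | upperBoxDim (graph f) ≤ (α : EReal)} ∩
      ({f | (α : EReal) ≤ lowerBoxDim (graph f)} ∩
        horizon ⁻¹' {g | ((α - 1 : ℝ) : EReal) ≤ lowerBoxDim (graph g)}) :=
    Set.ext fun f => mem_surfaces_iff
  rw [h]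
  exact (measurableSet_upperBoxDim_le (by simpa using hα)).inter
    ((measurableSet_le_lowerBoxDim α).inter
      (continuous_horizon.measurable (measurableSet_le_lowerBoxDim (α - 1))))

/-! ### A Takagi-type function -/

/-- The distance to the nearest integer. -/
noncomputable def distInt (x : ℝ) : ℝ := |x - round x|

lemma distInt_nonneg (x : ℝ) : 0 ≤ distInt x := abs_nonneg _

lemma distInt_le_half (x : ℝ) : distInt x ≤ 1 / 2 := abs_sub_round x

lemma distInt_le (x : ℝ) (z : ℤ) : distInt x ≤ |x - z| := round_le x z

lemma distInt_intCast (z : ℤ) : distInt z = 0 := by simp [distInt]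

lemma distInt_sub_le (x y : ℝ) : distInt x - distInt y ≤ |x - y| := by
  have h1 := distInt_le x (round y)
  have h2 := abs_sub_le x y (round y)
  unfold distInt at *
  linarith

lemma abs_distInt_sub_le (x y : ℝ) : |distInt x - distInt y| ≤ |x - y| := by
  rw [abs_sub_le_iff]
  exact ⟨distInt_sub_le x y, by rw [abs_sub_comm]; exact distInt_sub_le y x⟩

lemma continuous_distInt : Continuous distInt :=
  LipschitzWith.continuous (K := 1) (LipschitzWith.of_dist_le_mul fun x y => by
    simpa [Real.dist_eq] using abs_distInt_sub_le x y)

/-- The difference is at most `min r 1` with `r = |x - y|`, and `min r 1 ≤ r ^ s` for exponents in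
`[0, 1]`. -/
lemma abs_distInt_sub_le_rpow {s : ℝ} (h0 : 0 ≤ s) (h1 : s ≤ 1) (x y : ℝ) :
    |distInt x - distInt y| ≤ |x - y| ^ s := by
  rcases le_total |x - y| 1 with h | h
  · refine (abs_distInt_sub_le x y).trans ?_
    rcases (abs_nonneg (x - y)).eq_or_lt with h2 | h2
    · rw [← h2]; exact Real.rpow_nonneg le_rfl _
    · simpa using Real.rpow_le_rpow_of_exponent_ge h2 h h1
  · refine le_trans ?_ (Real.one_le_rpow h h0)
    rw [abs_le]
    constructor <;>
      linarith [distInt_nonneg x, distInt_nonneg y, distInt_le_half x, distInt_le_half y]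

/-- No integer lies strictly between `i` and `i + 1`, so the nearest one is on one of the two sides.
-/
lemma min_le_distInt (x : ℝ) (i : ℤ) : min (x - i) (i + 1 - x) ≤ distInt x := by
  unfold distInt
  rcases le_or_gt (round x) i with h | h
  · have h' : ((round x : ℤ) : ℝ) ≤ i := by exact_mod_cast h
    exact (min_le_left _ _).trans (le_trans (by linarith) (le_abs_self _))
  · have h' : (i : ℝ) + 1 ≤ (round x : ℤ) := by exact_mod_cast h
    exact (min_le_right _ _).trans (le_trans (by linarith) (neg_le_abs _))

/-- The distance to the nearest integer is midpoint concave on `[i, i + 1]`. -/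
lemma distInt_add_le {x y : ℝ} {i : ℤ} (hx : x ∈ Set.Icc (i : ℝ) (i + 1))
    (hy : y ∈ Set.Icc (i : ℝ) (i + 1)) : distInt x + distInt y ≤ 2 * distInt ((x + y) / 2) := by
  have hb : ∀ z ∈ Set.Icc (i : ℝ) (i + 1), distInt z ≤ z - i ∧ distInt z ≤ i + 1 - z := by
    intro z hz
    constructor
    · have := distInt_le z i
      rwa [abs_of_nonneg (by linarith [hz.1])] at this
    · have := distInt_le z (i + 1)
      push_cast at this
      rwa [abs_sub_comm, abs_of_nonneg (by linarith [hz.2])] at this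
  have h := min_le_distInt ((x + y) / 2) i
  obtain ⟨h1, h2⟩ := hb x hx
  obtain ⟨h3, h4⟩ := hb y hy
  rcases min_le_iff.1 h with h5 | h5 <;> linarith

lemma distInt_intCast_add_half (j : ℤ) : distInt (j + 1 / 2) = 1 / 2 := by
  refine le_antisymm (distInt_le_half _) ?_
  have := min_le_distInt ((j : ℝ) + 1 / 2) j
  rcases min_le_iff.1 this with h | h <;> linarith

/-- The amplitudes of `takagi s`. -/
noncomputable def amplitude (s : ℝ) (k : ℕ) : ℝ := (2 : ℝ) ^ (-(s * k)) / ((k : ℝ) + 1) ^ 2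

/-- A Takagi-type function, of Hölder exponent exactly `s` up to logarithmic factors. -/
noncomputable def takagi (s : ℝ) (x : ℝ) : ℝ := ∑' k : ℕ, amplitude s k * distInt (2 ^ k * x)

lemma amplitude_pos (s : ℝ) (k : ℕ) : 0 < amplitude s k := by unfold amplitude; positivity

lemma summable_one_div_succ_sq : Summable fun k : ℕ => 1 / ((k : ℝ) + 1) ^ 2 := by
  have h := (summable_nat_add_iff 1).2 (Real.summable_one_div_nat_pow.2 one_lt_two)
  simpa using h

lemma amplitude_le {s : ℝ} (h0 : 0 ≤ s) (k : ℕ) : amplitude s k ≤ 1 / ((k : ℝ) + 1) ^ 2 := by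
  unfold amplitude
  refine div_le_div_of_nonneg_right ?_ (by positivity)
  refine Real.rpow_le_one_of_one_le_of_nonpos one_le_two ?_
  have : 0 ≤ s * k := by positivity
  linarith

lemma takagi_term_le {s : ℝ} (h0 : 0 ≤ s) (k : ℕ) (x : ℝ) :
    ‖amplitude s k * distInt (2 ^ k * x)‖ ≤ 1 / ((k : ℝ) + 1) ^ 2 := by
  have h1 := distInt_nonneg (2 ^ k * x)
  have h2 := distInt_le_half (2 ^ k * x)
  have h3 := amplitude_pos s k
  rw [Real.norm_of_nonneg (by positivity)]
  refine le_trans ?_ (amplitude_le h0 k)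
  exact mul_le_of_le_one_right h3.le (by linarith)

lemma summable_takagi {s : ℝ} (h0 : 0 ≤ s) (x : ℝ) :
    Summable fun k : ℕ => amplitude s k * distInt (2 ^ k * x) :=
  Summable.of_norm_bounded summable_one_div_succ_sq fun k => takagi_term_le h0 k x

lemma continuous_takagi {s : ℝ} (h0 : 0 ≤ s) : Continuous (takagi s) :=
  continuous_tsum (fun _ => continuous_const.mul
    (continuous_distInt.comp (continuous_const.mul continuous_id)))
    summable_one_div_succ_sq fun k x => takagi_term_le h0 k x

/-- In the `k`-th term `2^(-sk)` cancels the dilation factor `(2^k)^s`, leaving `|x - y|^s / (k +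
1)^2`. The summable weight thus gives the exponent `s` itself, including `s = 0`, at the price of a
polynomial loss in the lower bounds. -/
lemma exists_takagi_holder {s : ℝ} (h0 : 0 ≤ s) (h1 : s ≤ 1) :
    ∃ C, 0 ≤ C ∧ ∀ x y, |takagi s x - takagi s y| ≤ C * |x - y| ^ s := by
  refine ⟨∑' k : ℕ, 1 / ((k : ℝ) + 1) ^ 2, tsum_nonneg fun k => by positivity, fun x y => ?_⟩
  unfold takagi
  rw [← (summable_takagi h0 x).tsum_sub (summable_takagi h0 y), ← tsum_mul_right,
    ← Real.norm_eq_abs]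
  refine tsum_of_norm_bounded (summable_one_div_succ_sq.mul_right _).hasSum fun k => ?_
  rw [← mul_sub, norm_mul, Real.norm_of_nonneg (amplitude_pos s k).le, Real.norm_eq_abs]
  have h2 := abs_distInt_sub_le_rpow h0 h1 (2 ^ k * x) (2 ^ k * y)
  rw [← mul_sub, abs_mul, abs_of_pos (by positivity : (0 : ℝ) < 2 ^ k),
    Real.mul_rpow (by positivity) (abs_nonneg _)] at h2
  refine (mul_le_mul_of_nonneg_left h2 (amplitude_pos s k).le).trans (le_of_eq ?_)
  have h3 : (2 : ℝ) ^ (-(s * k)) * ((2 : ℝ) ^ k) ^ s = 1 := by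
    rw [← Real.rpow_natCast, ← Real.rpow_mul (by norm_num), ← Real.rpow_add (by norm_num)]
    ring_nf
    simp
  unfold amplitude
  rw [← mul_assoc, div_mul_eq_mul_div, h3]

/-- The second difference of `takagi s` on a dyadic interval of level `n`. -/
lemma amplitude_le_takagi {s : ℝ} (h0 : 0 ≤ s) (n j : ℕ) :
    amplitude s n ≤ 2 * takagi s ((j + 1 / 2) * (2 : ℝ)⁻¹ ^ n) -
      (takagi s (j * (2 : ℝ)⁻¹ ^ n) + takagi s ((j + 1) * (2 : ℝ)⁻¹ ^ n)) := by
  set a : ℝ := j * (2 : ℝ)⁻¹ ^ n with ha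
  set b : ℝ := (j + 1) * (2 : ℝ)⁻¹ ^ n with hb
  set m : ℝ := (j + 1 / 2) * (2 : ℝ)⁻¹ ^ n with hm
  have hsum := ((summable_takagi h0 m).mul_left 2).sub
    ((summable_takagi h0 a).add (summable_takagi h0 b))
  have heq : 2 * takagi s m - (takagi s a + takagi s b) =
      ∑' k : ℕ, (2 * (amplitude s k * distInt (2 ^ k * m)) -
        (amplitude s k * distInt (2 ^ k * a) + amplitude s k * distInt (2 ^ k * b))) := by
    unfold takagi
    rw [← tsum_mul_left, ← (summable_takagi h0 a).tsum_add (summable_takagi h0 b),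
      ((summable_takagi h0 m).mul_left 2).tsum_sub
        ((summable_takagi h0 a).add (summable_takagi h0 b))]
  have hpow : ∀ k, n ≤ k → (2 : ℝ) ^ k * (2 : ℝ)⁻¹ ^ n = 2 ^ (k - n) := by
    intro k hk
    obtain ⟨l, rfl⟩ := Nat.exists_eq_add_of_le hk
    rw [Nat.add_sub_cancel_left, pow_add, inv_pow]
    field_simp
  have hz : ∀ k, n ≤ k → ∀ i : ℕ, distInt (2 ^ k * (i * (2 : ℝ)⁻¹ ^ n)) = 0 := by
    intro k hk i
    have h : (2 : ℝ) ^ k * (i * (2 : ℝ)⁻¹ ^ n) = ((i * 2 ^ (k - n) : ℕ) : ℤ) := by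
      rw [mul_left_comm, hpow k hk]; push_cast; ring
    rw [h, distInt_intCast]
  have hza : ∀ k, n ≤ k → distInt (2 ^ k * a) = 0 := fun k hk => hz k hk j
  have hzb : ∀ k, n ≤ k → distInt (2 ^ k * b) = 0 := fun k hk => by
    have := hz k hk (j + 1)
    push_cast at this
    exact this
  -- No term has a negative second difference: for `k ≥ n` the endpoints are sent to integers, and
  -- for `k < n` the image of the interval lies between two consecutive integers, where `distInt` is
  -- concave.
  have hconc : ∀ k, distInt (2 ^ k * a) + distInt (2 ^ k * b) ≤ 2 * distInt (2 ^ k * m) := by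
    intro k
    rcases le_or_gt n k with hk | hk
    · rw [hza k hk, hzb k hk]
      linarith [distInt_nonneg (2 ^ k * m)]
    · have hmid : (2 : ℝ) ^ k * m = (2 ^ k * a + 2 ^ k * b) / 2 := by rw [ha, hb, hm]; ring
      rw [hmid]
      set q : ℕ := 2 ^ (n - k) with hq
      have hq0 : (0 : ℝ) < q := by rw [hq]; positivity
      have hkq : (2 : ℝ) ^ k * (2 : ℝ)⁻¹ ^ n = (q : ℝ)⁻¹ := by
        obtain ⟨l, rfl⟩ := Nat.exists_eq_add_of_le hk.le
        rw [hq, Nat.add_sub_cancel_left, pow_add, inv_pow]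
        push_cast
        field_simp
        rw [← mul_pow]
        norm_num
      have e1 : (2 : ℝ) ^ k * a = j / q := by rw [ha, mul_left_comm, hkq]; rfl
      have e2 : (2 : ℝ) ^ k * b = (j + 1) / q := by rw [hb, mul_left_comm, hkq]; rfl
      -- The unit interval containing `[j / q, (j + 1) / q]` starts at the integer quotient of `j`
      -- by `q`.
      have hlt : j < q * (j / q + 1) := Nat.lt_mul_div_succ j (by exact_mod_cast hq0)
      have hle : q * (j / q) ≤ j := Nat.mul_div_le j q
      have hlt' : (j : ℝ) + 1 ≤ q * ((j / q : ℕ) + 1) := by exact_mod_cast hlt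
      have hle' : (q : ℝ) * (j / q : ℕ) ≤ j := by exact_mod_cast hle
      refine distInt_add_le (i := ((j / q : ℕ) : ℤ)) ?_ ?_
      · rw [e1, Int.cast_natCast]
        constructor
        · rw [le_div_iff₀ hq0]; linarith
        · rw [div_le_iff₀ hq0]; linarith
      · rw [e2, Int.cast_natCast]
        constructor
        · rw [le_div_iff₀ hq0]; linarith
        · rw [div_le_iff₀ hq0]; linarith
  -- The term `k = n` alone contributes the full bound, since its midpoint is sent to a
  -- half-integer.
  have hn : amplitude s n = 2 * (amplitude s n * distInt (2 ^ n * m)) -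
      (amplitude s n * distInt (2 ^ n * a) + amplitude s n * distInt (2 ^ n * b)) := by
    have h : (2 : ℝ) ^ n * m = ((j : ℤ) : ℝ) + 1 / 2 := by
      rw [hm, mul_left_comm, hpow n le_rfl]; simp
    rw [hza n le_rfl, hzb n le_rfl, h, distInt_intCast_add_half]
    ring
  rw [heq]
  refine hn.le.trans (hsum.le_tsum n fun k _ => ?_)
  have h2 := mul_le_mul_of_nonneg_left (hconc k) (amplitude_pos s k).le
  linarith

/-! ### The probe -/

/-- The function `x ↦ takagi s (x 0)` on the cube. -/
noncomputable def ridge (d : ℕ) [NeZero d] {s : ℝ} (h0 : 0 ≤ s) : CCube d where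
  toFun x := takagi s (x 0)
  continuous_toFun := (continuous_takagi h0).comp
    (continuous_subtype_val.comp (continuous_apply 0))

lemma ridge_apply {d : ℕ} [NeZero d] {s : ℝ} (h0 : 0 ≤ s) (x : Fin d → I) :
    ridge d h0 x = takagi s (x 0) := rfl

lemma boxNorm_ridge_ne_top (d : ℕ) [NeZero d] {s : ℝ} (h0 : 0 ≤ s) (h1 : s ≤ 1) :
    boxNorm (d + 1 - s) (ridge d h0) ≠ ⊤ := by
  obtain ⟨C, hC, h⟩ := exists_takagi_holder h0 h1
  refine boxNorm_ne_top_of_osc_le hC fun δ hδ p => ?_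
  rw [osc_le_iff]
  intro x hx y hy
  refine ENNReal.ofReal_le_ofReal ((h _ _).trans (mul_le_mul_of_nonneg_left ?_ hC))
  refine Real.rpow_le_rpow (abs_nonneg _) ?_ h0
  have hx0 := hx 0
  have hy0 := hy 0
  rw [abs_le]
  constructor <;> linarith [hx0.1, hx0.2, hy0.1, hy0.2]

lemma upperBoxDim_ridge_le (d : ℕ) [NeZero d] {s : ℝ} (h0 : 0 ≤ s) (h1 : s ≤ 1) :
    upperBoxDim (graph (ridge d h0)) ≤ ((d + 1 - s : ℝ) : EReal) :=
  upperBoxDim_le_of_boxNorm (by linarith) (boxNorm_ridge_ne_top d h0 h1)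

/-- The second difference is the sum of the two differences between the midpoint value and the
endpoint values, so one of them is at least half of it. -/
lemma le_osc_ridge {d : ℕ} [NeZero d] {s : ℝ} (h0 : 0 ≤ s) {n : ℕ} {δ : ℝ}
    (hδ : δ = (2 : ℝ)⁻¹ ^ n) (p : Fin d → Fin ⌈δ⁻¹⌉₊) :
    ENNReal.ofReal (amplitude s n / 2) ≤ osc (ridge d h0) (gridCube δ p) := by
  have hδ0 : 0 < δ := by rw [hδ]; positivity
  have hceil : ⌈δ⁻¹⌉₊ = 2 ^ n := by
    rw [hδ, inv_pow, inv_inv]; exact_mod_cast Nat.ceil_natCast (R := ℝ) (2 ^ n)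
  have hp : ∀ i, (((p i : ℕ) : ℝ) + 1) * δ ≤ 1 := by
    intro i
    have h1 : (p i : ℕ) + 1 ≤ 2 ^ n := by rw [← hceil]; exact (p i).2
    have h2 : ((p i : ℕ) : ℝ) + 1 ≤ 2 ^ n := by exact_mod_cast h1
    refine (mul_le_mul_of_nonneg_right h2 hδ0.le).trans (le_of_eq ?_)
    rw [hδ, inv_pow]; field_simp
  -- Points on the diagonal of the cube: `u = 0, 1/2, 1` give the endpoints and the midpoint in the
  -- first coordinate. They stay in `[0,1]^d` because dyadic meshes fit the cube exactly.
  let pt : ∀ u ∈ Set.Icc (0 : ℝ) 1, Fin d → I := fun u hu i =>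
    ⟨(((p i : ℕ) : ℝ) + u) * δ, by have := hu.1; positivity,
      (mul_le_mul_of_nonneg_right (by linarith [hu.2]) hδ0.le).trans (hp i)⟩
  have hpt : ∀ u hu, pt u hu ∈ gridCube δ p := fun u hu i =>
    ⟨mul_le_mul_of_nonneg_right (by linarith [hu.1]) hδ0.le,
      mul_le_mul_of_nonneg_right (by linarith [hu.2]) hδ0.le⟩
  have hm : (1 / 2 : ℝ) ∈ Set.Icc (0 : ℝ) 1 := by constructor <;> norm_num
  have ha := ofReal_abs_le_osc (ridge d h0) (hpt _ hm) (hpt 0 (by simp))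
  have hb := ofReal_abs_le_osc (ridge d h0) (hpt _ hm) (hpt 1 (by simp))
  have hkey := amplitude_le_takagi h0 n (p 0)
  rw [← hδ] at hkey
  simp only [ridge_apply, pt, add_zero] at ha hb
  rcases le_total (amplitude s n / 2)
      (takagi s ((((p 0 : ℕ) : ℝ) + 1 / 2) * δ) - takagi s (((p 0 : ℕ) : ℝ) * δ)) with h | h
  · exact (ENNReal.ofReal_le_ofReal (h.trans (le_abs_self _))).trans ha
  · refine (ENNReal.ofReal_le_ofReal (le_trans ?_ (le_abs_self _))).trans hb
    linarith

lemma oscSum_ne_top {d : ℕ} (δ : ℝ) (f : CCube d) : oscSum δ f ≠ ⊤ :=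
  ENNReal.sum_ne_top.2 fun _ _ => osc_ne_top f _

/-- All `2^(nd)` cubes contribute at least half the amplitude. The exponent is left in the shape `β
- 1`, with `β = d + 1 - s`, for `ae_le_lowerBoxDim`. -/
lemma le_oscSum_ridge (d : ℕ) [NeZero d] {s : ℝ} (h0 : 0 ≤ s) (n : ℕ) :
    (2 : ℝ) ^ ((n : ℝ) * (d + 1 - s - 1)) / (2 * ((n : ℝ) + 1) ^ 2) ≤
      (oscSum ((2 : ℝ)⁻¹ ^ n) (ridge d h0)).toReal := by
  have hceil : ⌈((2 : ℝ)⁻¹ ^ n)⁻¹⌉₊ = 2 ^ n := by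
    rw [inv_pow, inv_inv]; exact_mod_cast Nat.ceil_natCast (R := ℝ) (2 ^ n)
  rw [← ENNReal.ofReal_le_iff_le_toReal (oscSum_ne_top _ _)]
  have h : ∑ _p : Fin d → Fin ⌈((2 : ℝ)⁻¹ ^ n)⁻¹⌉₊, ENNReal.ofReal (amplitude s n / 2) ≤
      oscSum ((2 : ℝ)⁻¹ ^ n) (ridge d h0) := Finset.sum_le_sum fun p _ =>
      le_osc_ridge h0 rfl p
  refine le_trans (le_of_eq ?_) h
  simp only [Finset.sum_const, Finset.card_univ, Fintype.card_pi, Fintype.card_fin,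
    Finset.prod_const, nsmul_eq_mul, hceil]
  rw [← ENNReal.ofReal_natCast, ← ENNReal.ofReal_mul (Nat.cast_nonneg _)]
  congr 1
  have h1 : (2 : ℝ) ^ ((n : ℝ) * (d + 1 - s - 1)) = ((2 : ℝ) ^ n) ^ d * (2 : ℝ) ^ (-(s * n)) := by
    rw [← pow_mul, ← Real.rpow_natCast, ← Real.rpow_add (by norm_num)]
    push_cast
    congr 1
    ring
  rw [h1, amplitude]
  push_cast
  field_simp

lemma horizon_add_smul_ridge {s : ℝ} (h0 : 0 ≤ s) (f : CCube 2) (t : ℝ) :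
    horizon (f + t • ridge 2 h0) = horizon f + t • ridge 1 h0 := by
  ext x
  simp only [horizon_apply, ContinuousMap.add_apply, ContinuousMap.smul_apply, ridge_apply,
    smul_eq_mul, Matrix.cons_val_zero, Fin.isValue]
  exact (ciSup_add (bddAbove_range_section f (x 0)) _).symm

/-! ### Lower box dimensions along lines -/

lemma oscSum_add_le {d : ℕ} (δ : ℝ) (f g : CCube d) :
    oscSum δ (f + g) ≤ oscSum δ f + oscSum δ g := by
  unfold oscSum
  rw [← Finset.sum_add_distrib]
  exact Finset.sum_le_sum fun n _ => osc_add_le f g _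

lemma oscSum_smul_le {d : ℕ} (δ c : ℝ) (f : CCube d) :
    oscSum δ (c • f) ≤ ENNReal.ofReal |c| * oscSum δ f := by
  unfold oscSum
  rw [Finset.mul_sum]
  exact Finset.sum_le_sum fun n _ => osc_smul_le c f _

lemma toReal_oscSum_smul_le {d : ℕ} (δ c : ℝ) (f : CCube d) :
    (oscSum δ (c • f)).toReal ≤ |c| * (oscSum δ f).toReal := by
  have h := ENNReal.toReal_mono (ENNReal.mul_ne_top ENNReal.ofReal_ne_top (oscSum_ne_top δ f))
    (oscSum_smul_le δ c f)
  rwa [ENNReal.toReal_mul, ENNReal.toReal_ofReal (abs_nonneg c)] at h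

lemma toReal_oscSum_add_le {d : ℕ} (δ : ℝ) (f g : CCube d) :
    (oscSum δ (f + g)).toReal ≤ (oscSum δ f).toReal + (oscSum δ g).toReal := by
  rw [← ENNReal.toReal_add (oscSum_ne_top _ _) (oscSum_ne_top _ _)]
  exact ENNReal.toReal_mono (ENNReal.add_ne_top.2 ⟨oscSum_ne_top _ _, oscSum_ne_top _ _⟩)
    (oscSum_add_le δ f g)

/-- Subadditivity applied to `(t - u) φ = (f + t φ) - (f + u φ)`: two points of the line cannot both
have small range sums unless they are close. -/
lemma abs_sub_mul_oscSum_le {d : ℕ} (δ t u : ℝ) (f φ : CCube d) :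
    |t - u| * (oscSum δ φ).toReal ≤
      (oscSum δ (f + t • φ)).toReal + (oscSum δ (f + u • φ)).toReal := by
  rcases eq_or_ne (t - u) 0 with h | h
  · rw [h, abs_zero, zero_mul]; positivity
  have h1 := toReal_oscSum_smul_le δ (t - u)⁻¹ ((t - u) • φ)
  rw [smul_smul, inv_mul_cancel₀ h, one_smul, abs_inv, ← div_eq_inv_mul,
    le_div_iff₀ (abs_pos.2 h), mul_comm] at h1
  have h2 := toReal_oscSum_add_le δ (f + t • φ) ((-1 : ℝ) • (f + u • φ))
  have h3 := toReal_oscSum_smul_le δ (-1) (f + u • φ)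
  have h4 : f + t • φ + (-1 : ℝ) • (f + u • φ) = (t - u) • φ := by module
  rw [h4] at h2
  rw [abs_neg, abs_one, one_mul] at h3
  linarith

lemma oscSum_toReal_le_of_log_boxCount_le {d : ℕ} {f : CCube d} {δ c : ℝ} (hδ : 0 < δ)
    (h : Real.log (boxCount δ (graph f)) ≤ c) : (oscSum δ f).toReal ≤ δ * Real.exp c := by
  refine ENNReal.toReal_le_of_le_ofReal (by positivity) ((oscSum_le f hδ).trans
    (ENNReal.ofReal_le_ofReal (mul_le_mul_of_nonneg_left ?_ hδ.le)))
  rcases (boxCount δ (graph f)).eq_zero_or_pos with h0 | h0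
  · rw [h0, Nat.cast_zero]; positivity
  · exact (Real.log_le_iff_le_exp (by exact_mod_cast h0)).1 h

lemma summable_succ_sq_mul_geometric {q : ℝ} (h0 : 0 < q) (h1 : q < 1) :
    Summable fun n : ℕ => 4 * ((n : ℝ) + 1) ^ 2 * q ^ n := by
  have h := summable_pow_mul_geometric_of_norm_lt_one 2 (r := q)
    (by rwa [Real.norm_of_nonneg h0.le])
  refine (((summable_nat_add_iff 1).2 h).mul_left (4 * q⁻¹)).congr fun n => ?_
  push_cast
  field_simp
  ring

/-- If the range sums of `φ` over the dyadic meshes are, up to a factor of polynomial growth, at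
least those of a function with graph of dimension `β`, then almost every function on any line in
the direction of `φ` has a graph of lower box dimension at least `β`. -/
lemma ae_le_lowerBoxDim {d : ℕ} {φ : CCube d} {β : ℝ}
    (hφ : ∀ n : ℕ, (2 : ℝ) ^ ((n : ℝ) * (β - 1)) / (2 * ((n : ℝ) + 1) ^ 2) ≤
      (oscSum ((2 : ℝ)⁻¹ ^ n) φ).toReal) (f : CCube d) :
    ∀ᵐ t : ℝ, (β : EReal) ≤ lowerBoxDim (graph (f + t • φ)) := by
  simp only [le_lowerBoxDim_iff]
  rw [ae_all_iff]
  intro j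
  set ε : ℝ := 1 / ((j : ℝ) + 1) with hε
  have hε0 : 0 < ε := Nat.one_div_pos_of_nat
  set q : ℝ := (2 : ℝ) ^ (-ε) with hq
  have hq0 : 0 < q := by positivity
  have hq1 : q < 1 := Real.rpow_lt_one_of_one_lt_of_neg one_lt_two (by linarith)
  -- The parameters with too few boxes at scale `2^(-n)`.
  let B : ℕ → Set ℝ := fun n => {t | ¬ (n : ℝ) * (β - ε) * Real.log 2 ≤
    Real.log (boxCount ((2 : ℝ)⁻¹ ^ n) (graph (f + t • φ)))}
  have hdiam : ∀ n, ∀ t ∈ B n, ∀ u ∈ B n, |t - u| ≤ 4 * ((n : ℝ) + 1) ^ 2 * q ^ n := by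
    intro n t ht u hu
    have hD : (0 : ℝ) < (2 : ℝ)⁻¹ ^ n := by positivity
    have ht' := oscSum_toReal_le_of_log_boxCount_le hD (not_le.1 ht).le
    have hu' := oscSum_toReal_le_of_log_boxCount_le hD (not_le.1 hu).le
    have h1 := abs_sub_mul_oscSum_le ((2 : ℝ)⁻¹ ^ n) t u f φ
    have h2 := mul_le_mul_of_nonneg_left (hφ n) (abs_nonneg (t - u))
    set P : ℝ := (2 : ℝ) ^ ((n : ℝ) * (β - 1)) with hP
    have hP0 : 0 < P := by positivity
    -- Each bad parameter has range sum at most `P q^n`; two of them, against `P / (2 (n + 1)^2)`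
    -- for `φ`, give the constant 4.
    have h3 : (2 : ℝ)⁻¹ ^ n * Real.exp ((n : ℝ) * (β - ε) * Real.log 2) = P * q ^ n := by
      have h4 : Real.exp ((n : ℝ) * (β - ε) * Real.log 2) = (2 : ℝ) ^ ((n : ℝ) * (β - ε)) := by
        rw [Real.rpow_def_of_pos two_pos, mul_comm]
      have h5 : (2 : ℝ)⁻¹ ^ n = (2 : ℝ) ^ (-(n : ℝ)) := by
        rw [Real.rpow_neg two_pos.le, Real.rpow_natCast, inv_pow]
      rw [h4, h5, hP, hq, ← Real.rpow_natCast, ← Real.rpow_mul two_pos.le,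
        ← Real.rpow_add two_pos, ← Real.rpow_add two_pos]
      congr 1
      ring
    rw [h3] at ht' hu'
    have h6 : |t - u| * (P / (2 * ((n : ℝ) + 1) ^ 2)) ≤ 2 * (P * q ^ n) := by linarith
    rw [mul_div_assoc', div_le_iff₀ (by positivity)] at h6
    refine le_of_mul_le_mul_right (h6.trans (le_of_eq ?_)) hP0
    ring
  have hvol : ∀ n, volume (B n) ≤ ENNReal.ofReal (4 * ((n : ℝ) + 1) ^ 2 * q ^ n) := by
    intro n
    -- Outer measure on the line is at most the diameter, so measurability of `B n` plays no role.
    refine (Real.volume_le_diam _).trans (Metric.ediam_le fun t ht u hu => ?_)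
    rw [edist_dist, Real.dist_eq]
    exact ENNReal.ofReal_le_ofReal (hdiam n t ht u hu)
  have hsum : ∑' n, volume (B n) ≠ ∞ :=
    ne_top_of_le_ne_top (summable_succ_sq_mul_geometric hq0 hq1).tsum_ofReal_ne_top
      (ENNReal.tsum_le_tsum hvol)
  -- Borel–Cantelli.
  filter_upwards [ae_eventually_notMem hsum] with t ht
  filter_upwards [ht] with n hn
  exact not_not.1 hn

lemma ae_add_smul_ridge_mem_surfaces {s : ℝ} (h0 : 0 ≤ s) {f : CCube 2}
    (hf : ∀ t : ℝ, upperBoxDim (graph (f + t • ridge 2 h0)) ≤ ((3 - s : ℝ) : EReal)) :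
    ∀ᵐ t : ℝ, f + t • ridge 2 h0 ∈ surfaces (3 - s) := by
  have h2 := ae_le_lowerBoxDim (le_oscSum_ridge 2 h0) f
  have h1 := ae_le_lowerBoxDim (le_oscSum_ridge 1 h0) (horizon f)
  filter_upwards [h1, h2] with t ht1 ht2
  rw [mem_surfaces_iff, horizon_add_smul_ridge]
  refine ⟨hf t, ?_, ?_⟩
  · convert ht2 using 2
    push_cast
    ring
  · convert ht1 using 2
    push_cast
    ring

/-- At level `n = 0` the range sum is already at least `1/2`. -/
lemma ridge_ne_zero (d : ℕ) [NeZero d] {s : ℝ} (h0 : 0 ≤ s) : ridge d h0 ≠ 0 := by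
  intro h
  have h1 := le_oscSum_ridge d h0 0
  have h2 := toReal_oscSum_smul_le ((2 : ℝ)⁻¹ ^ 0) 0 (0 : CCube d)
  rw [zero_smul, abs_zero, zero_mul] at h2
  rw [h] at h1
  norm_num at h1 h2
  linarith

/-! ### One-dimensional probes -/

lemma isProbe_span_singleton {X : Type*} [AddCommGroup X] [Module ℝ X] {φ : X} (hφ : φ ≠ 0)
    {F : Set X} (h : ∀ x : X, ∀ᵐ t : ℝ, x + t • φ ∈ F) : IsProbe 1 (Submodule.span ℝ {φ}) F := by
  refine ⟨(Module.Basis.singleton (Fin 1) ℝ).map (LinearEquiv.toSpanNonzeroSingleton ℝ X φ hφ),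
    fun x => ?_⟩
  -- The translate is taken at `-x`, because `t • φ ∈ F + x` iff `-x + t • φ ∈ F`.
  have hq := (volume_preserving_funUnique (Fin 1) ℝ).quasiMeasurePreserving.ae (h (-x))
  refine measure_mono_null (fun t ht => ?_) hq
  simp only [Set.mem_compl_iff, Set.mem_ofPred_eq] at ht ⊢
  refine fun hF => ht ⟨_, hF, ?_⟩
  simp [MeasurableEquiv.funUnique]

end Horizon

/-! ### Assembly of the two parts of the theorem -/

open Horizon in
theorem theorem1p2 :
    Horizon.IsKPrevalent 1 (Horizon.surfaces 3) ∧
    (∀ f ∈ Horizon.surfaces 3, Horizon.HasBoxDim (Horizon.graph f) 3 ∧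
      Horizon.HasBoxDim (Horizon.graph (Horizon.horizon f)) 2) ∧
    ∀ (α : ℝ) (hα : ((2 : ℕ) : ℝ) ≤ α), α < 3 →
      Horizon.IsKPrevalent 1
        {f : Horizon.BoxSpace 2 α hα | f.toC ∈ Horizon.surfaces α} := by
  refine ⟨⟨measurableSet_surfaces (by norm_num), _,
    isProbe_span_singleton (ridge_ne_zero 2 le_rfl) fun f => ?_⟩, fun f hf => ?_, fun α hα h3 => ?_⟩
  -- Here `s = 0`, and the required upper bound 3 holds for every continuous function.
  · have h := ae_add_smul_ridge_mem_surfaces le_rfl (f := f) fun t =>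
      (upperBoxDim_graph_le _).trans (by norm_num)
    simpa using h
  · obtain ⟨-, h1, h2, -, h3⟩ := hf
    have e3 : ((3 : ℝ) : EReal) = 3 := rfl
    have e2 : ((3 - 1 : ℝ) : EReal) = 2 := by norm_num; rfl
    rw [e3] at h1
    rw [e2] at h2
    have h4 := lowerBoxDim_le_upperBoxDim (graph (horizon f))
    exact ⟨h1, le_antisymm (h4.trans h3) h2, le_antisymm h3 (h2.trans h4)⟩
  · have hα' : (2 : ℝ) ≤ α := by exact_mod_cast hα
    have h0 : 0 ≤ 3 - α := by linarith
    have e : 3 - (3 - α) = α := sub_sub_cancel 3 α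
    -- With `s = 3 - α ≤ 1`, Hölder continuity puts the probe direction inside `C_α`.
    have hmem : ridge 2 h0 ∈ boxSubmodule 2 α hα := by
      have h := upperBoxDim_ridge_le 2 h0 (by linarith)
      have e' : (((2 : ℕ) : ℝ) + 1 - (3 - α)) = α := by push_cast; ring
      rwa [e'] at h
    let φ : BoxSpace 2 α hα := (⟨ridge 2 h0, hmem⟩ : boxSubmodule 2 α hα)
    have hφ : φ ≠ 0 := fun h => ridge_ne_zero 2 h0 (congrArg BoxSpace.toC h)
    refine ⟨?_, _, isProbe_span_singleton hφ fun f => ?_⟩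
    · borelize (BoxSpace 2 α hα) (CCube 2)
      -- The metric of `C_α` is finer than the supremum metric, so Borel sets of `C[0,1]^2` pull
      -- back to Borel sets.
      exact BoxSpace.uniformContinuous_toC.continuous.measurable (measurableSet_surfaces hα')
    · have h := ae_add_smul_ridge_mem_surfaces h0 (f := f.toC) fun t => by
        -- The upper bound along the line is membership in the vector space `C_α`.
        rw [e]; exact (f + t • φ).2
      rw [e] at h
      exact h
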